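/- **Theorem (variance of the entries of singular vector perturbations).** Fix $0<\tau<1$, an integer $r\ge 1$, and a probability measure $\nu$ on $\mathbb R$ with mean zero and variance one that satisfies a logarithmic Sobolev inequality. There are constants $C>0$ and $N$, depending only on $\tau$, $r$ and $\nu$, such that the following holds for all $n\ge N$ and all $p$ with $\tau<p/n<\tau^{-1}$ and $r\le\min(p,n)$. *Model.* Let $Z=\mathcal A^{1/2}X\mathcal B^{1/2}\in\mathbb R^{p\times n}$, where $\mathcal A\in\mathbb R^{p\times p}$ and $\mathcal B\in\mathbb R^{n\times n}$ are deterministic symmetric positive semidefinite matrices with all eigenvalues at most $\tau^{-1}$, and $X$ has i.i.d. $\mathcal N(0,1/n)$ entries. Let $G_{\mathbf u}\in\mathbb R^{p\times p}$ and $G_{\mathbf v}\in\mathbb R^{n\times n}$ have i.i.d. entries of law $\nu$, with $X,G_{\mathbf u},G_{\mathbf v}$ independent, and let $U=[\mathbf u_1,\dots,\mathbf u_p]$ and $V=[\mathbf v_1,\dots,\mathbf v_n]$ be the orthogonal factors of (measurable) QR factorizations of $G_{\mathbf u}$ and $G_{\mathbf v}$ (for instance, the Gram–Schmidt vectors of their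 columns). Let $\tau^{-1}>d_1>d_2>\dots>d_r>0$ be deterministic numbers, which may depend on $n$, with $|d_i-d_j|>\tau$ for $i\ne j$. The signal is $S=\sum_{i\le r}d_i\mathbf u_i\mathbf v_i^\top$ and the data matrix is $S+Z$. *First-order perturbations.* Put $U_r=[\mathbf u_1,\dots,\mathbf u_r]$, $U_c=[\mathbf u_{r+1},\dots,\mathbf u_p]$, $V_r=[\mathbf v_1,\dots,\mathbf v_r]$, $V_c=[\mathbf v_{r+1},\dots,\mathbf v_n]$, $\Sigma_r=\operatorname{diag}(d_1,\dots,d_r)$, and let $D_i$ be the $r\times r$ diagonal matrix with $(i,i)$ entry $0$ and $(j,j)$ entry $1/(d_i^2-d_j^2)$ for $j\ne i$. Define $$\Delta\mathbf u_i^r=d_iU_rD_iU_r^\top Z\mathbf v_i+U_rD_i\Sigma_rV_r^\top Z^\top\mathbf u_i,\qquad \Delta\mathbf u_i^c=d_i^{-1}U_cU_c^\top Z\mathbf v_i,\qquad \Delta\mathbf u_i=\Delta\mathbf u_i^r+\Delta\mathbf u_i^c,$$ $$\Delta\mathbf v_i^r=d_iV_rD_iV_r^\top Z^\top\mathbf u_i+V_rD_i\Sigma_rU_r^\top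 Z\mathbf v_i,\qquad \Delta\mathbf v_i^c=d_i^{-1}V_cV_c^\top Z^\top\mathbf u_i,\qquad \Delta\mathbf v_i=\Delta\mathbf v_i^r+\Delta\mathbf v_i^c .$$ *Conclusion.* For every $i\le r$ with $d_i\ge\tau$ (which is automatic for $i<r$), all $1\le a\le p$ and all $1\le b\le n$, the entries below are square integrable (the expectation is over $X$, $G_{\mathbf u}$ and $G_{\mathbf v}$) and $$\mathbb E[(\Delta\mathbf u_i)_a^2]\le \frac Cn,\qquad \mathbb E[(\Delta\mathbf u_i^c)_a^2]\le\frac Cn,\qquad \mathbb E[(\Delta\mathbf v_i)_b^2]\le \frac Cn,\qquad \mathbb E[(\Delta\mathbf v_i^c)_b^2]\le\frac Cn .$$ The noise-subspace components $\Delta\mathbf u_i^c,\Delta\mathbf v_i^c$ dominate, in the sense that $$\mathbb E[(\Delta\mathbf u_i^r)_a^2]\le\frac C{n^2},\qquad \mathbb E[(\Delta\mathbf v_i^r)_b^2]\le\frac C{n^2},$$ $$\bigl|\mathbb E[(\Delta\mathbf u_i)_a^2]-\mathbb E[(\Delta\mathbf u_i^c)_a^2]\bigr|\le\frac C{n^2},\qquad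 \bigl|\mathbb E[(\Delta\mathbf v_i)_b^2]-\mathbb E[(\Delta\mathbf v_i^c)_b^2]\bigr|\le\frac C{n^2}.$$ -/

import Mathlib

open MeasureTheory ProbabilityTheory Matrix

noncomputable section

/-- The logarithmic Sobolev inequality for a probability measure on the line: for some constant `c`,
`Ent_ν(f²) ≤ c ∫ |f'|² dν` for all test functions `f`. -/
def SatisfiesLogSobolev (ν : Measure ℝ) : Prop :=
  ∃ c : ℝ, 0 < c ∧ ∀ f : ℝ → ℝ, ContDiff ℝ 1 f → HasCompactSupport f →
    (∫ x, f x ^ 2 * Real.log (f x ^ 2) ∂ν) - (∫ x, f x ^ 2 ∂ν) * Real.log (∫ x, f x ^ 2 ∂ν)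
      ≤ c * ∫ x, deriv f x ^ 2 ∂ν

/-- A (measurable) way of computing the orthogonal factor of a QR factorization: for every square
matrix `G`, the matrix `Q G` is orthogonal and `R = (Q G)ᵀ G` is upper triangular. For invertible
`G` the columns of `Q G` are, up to signs, the Gram-Schmidt vectors of the columns of `G`. -/
structure IsQRFactor {m : ℕ} (Q : Matrix (Fin m) (Fin m) ℝ → Matrix (Fin m) (Fin m) ℝ) :
    Prop where
  measurable : Measurable fun (G : Fin m → Fin m → ℝ) (j k : Fin m) => Q (Matrix.of G) j k
  orthogonal : ∀ G, Q G ∈ orthogonalGroup (Fin m) ℝ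
  upperTriangular : ∀ G, ((Q G)ᵀ * G).BlockTriangular id

/-- The signal-plus-noise model `∑ i, d i • u i (v i)ᵀ + Z` of size `p × n` and rank `r`, where
`Z = A^{1/2} X B^{1/2}`, with regularity parameter `τ`. The matrices
`A = Qa diag(σa) Qaᵀ` and `B = Qb diag(σb) Qbᵀ` are symmetric positive semidefinite, `X` is
Gaussian, and the singular vectors come from QR factorizations of random matrices whose entries
have law `ν`. -/
structure SpikedModel (τ : ℝ) (ν : Measure ℝ) (r p n : ℕ) {Ω : Type*} [MeasurableSpace Ω]
    (P : Measure Ω) where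
  rank_le_rows : r ≤ p
  rank_le_cols : r ≤ n
  /-- aspect ratio -/
  lt_ratio : τ < (p : ℝ) / n
  ratio_lt : (p : ℝ) / n < τ⁻¹
  /-- eigendecomposition of `A` -/
  Qa : Matrix (Fin p) (Fin p) ℝ
  σa : Fin p → ℝ
  Qa_mem : Qa ∈ orthogonalGroup (Fin p) ℝ
  σa_nonneg : ∀ k, 0 ≤ σa k
  σa_le : ∀ k, σa k ≤ τ⁻¹
  /-- eigendecomposition of `B` -/
  Qb : Matrix (Fin n) (Fin n) ℝ
  σb : Fin n → ℝ
  Qb_mem : Qb ∈ orthogonalGroup (Fin n) ℝ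
  σb_nonneg : ∀ k, 0 ≤ σb k
  σb_le : ∀ k, σb k ≤ τ⁻¹
  /-- singular values of the signal -/
  d : Fin r → ℝ
  d_pos : ∀ i, 0 < d i
  d_anti : StrictAnti d
  d_lt : ∀ i, d i < τ⁻¹
  d_gap : ∀ i j, i ≠ j → τ < |d i - d j|
  /-- the three random matrices -/
  X : Ω → Matrix (Fin p) (Fin n) ℝ
  Gu : Ω → Matrix (Fin p) (Fin p) ℝ
  Gv : Ω → Matrix (Fin n) (Fin n) ℝ
  X_law : ∀ j k, HasLaw (fun ω => X ω j k) (gaussianReal 0 (1 / (n : NNReal))) P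
  Gu_law : ∀ j k, HasLaw (fun ω => Gu ω j k) ν P
  Gv_law : ∀ j k, HasLaw (fun ω => Gv ω j k) ν P
  /-- all entries of `X`, `Gu`, `Gv` together are independent -/
  indep : iIndepFun
    (fun (s : (Fin p × Fin n) ⊕ (Fin p × Fin p) ⊕ (Fin n × Fin n)) (ω : Ω) =>
      Sum.elim (fun jk => X ω jk.1 jk.2)
        (Sum.elim (fun jk => Gu ω jk.1 jk.2) (fun jk => Gv ω jk.1 jk.2)) s) P
  /-- the QR factorizations that produce the singular vectors -/
  qru : Matrix (Fin p) (Fin p) ℝ → Matrix (Fin p) (Fin p) ℝ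
  qrv : Matrix (Fin n) (Fin n) ℝ → Matrix (Fin n) (Fin n) ℝ
  qru_spec : IsQRFactor qru
  qrv_spec : IsQRFactor qrv

namespace SpikedModel

variable {τ : ℝ} {ν : Measure ℝ} {r p n : ℕ} {Ω : Type*} [MeasurableSpace Ω] {P : Measure Ω}

/-- `A^{1/2}`. -/
def sqrtA (M : SpikedModel τ ν r p n P) : Matrix (Fin p) (Fin p) ℝ :=
  M.Qa * diagonal (fun k => Real.sqrt (M.σa k)) * M.Qaᵀ

/-- `B^{1/2}`. -/
def sqrtB (M : SpikedModel τ ν r p n P) : Matrix (Fin n) (Fin n) ℝ :=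
  M.Qb * diagonal (fun k => Real.sqrt (M.σb k)) * M.Qbᵀ

/-- The noise matrix `Z = A^{1/2} X B^{1/2}`. -/
def Z (M : SpikedModel τ ν r p n P) (ω : Ω) : Matrix (Fin p) (Fin n) ℝ :=
  M.sqrtA * M.X ω * M.sqrtB

/-- The orthogonal matrix of left singular vectors (its columns). -/
def U (M : SpikedModel τ ν r p n P) (ω : Ω) : Matrix (Fin p) (Fin p) ℝ := M.qru (M.Gu ω)

/-- The orthogonal matrix of right singular vectors (its columns). -/
def V (M : SpikedModel τ ν r p n P) (ω : Ω) : Matrix (Fin n) (Fin n) ℝ := M.qrv (M.Gv ω)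

/-- `U_r`: the first `r` columns of `U`. -/
def Ur (M : SpikedModel τ ν r p n P) (ω : Ω) : Matrix (Fin p) (Fin r) ℝ :=
  (M.U ω).submatrix id (Fin.castLE M.rank_le_rows)

/-- `V_r`: the first `r` columns of `V`. -/
def Vr (M : SpikedModel τ ν r p n P) (ω : Ω) : Matrix (Fin n) (Fin r) ℝ :=
  (M.V ω).submatrix id (Fin.castLE M.rank_le_cols)

/-- `U_c`: the remaining columns of `U`. -/
def Uc (M : SpikedModel τ ν r p n P) (ω : Ω) : Matrix (Fin p) {g : Fin p // r ≤ (g : ℕ)} ℝ :=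
  (M.U ω).submatrix id Subtype.val

/-- `V_c`: the remaining columns of `V`. -/
def Vc (M : SpikedModel τ ν r p n P) (ω : Ω) : Matrix (Fin n) {g : Fin n // r ≤ (g : ℕ)} ℝ :=
  (M.V ω).submatrix id Subtype.val

/-- The left singular vector `u_i`. -/
def u (M : SpikedModel τ ν r p n P) (i : Fin r) (ω : Ω) : Fin p → ℝ := fun a => M.Ur ω a i

/-- The right singular vector `v_i`. -/
def v (M : SpikedModel τ ν r p n P) (i : Fin r) (ω : Ω) : Fin n → ℝ := fun b => M.Vr ω b i

/-- `Σ_r = diag(d_1, …, d_r)`. -/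
def Sig (M : SpikedModel τ ν r p n P) : Matrix (Fin r) (Fin r) ℝ := diagonal M.d

/-- `D_i`: diagonal, with `i`-th entry zero and `j`-th entry `1 / (d_i² - d_j²)` for `j ≠ i`. -/
def D (M : SpikedModel τ ν r p n P) (i : Fin r) : Matrix (Fin r) (Fin r) ℝ :=
  diagonal (fun j => if j = i then 0 else 1 / (M.d i ^ 2 - M.d j ^ 2))

/-- `Δu_i^r = d_i U_r D_i U_rᵀ Z v_i + U_r D_i Σ_r V_rᵀ Zᵀ u_i`. -/
def duR (M : SpikedModel τ ν r p n P) (i : Fin r) (ω : Ω) : Fin p → ℝ :=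
  M.d i • ((M.Ur ω * M.D i * (M.Ur ω)ᵀ * M.Z ω) *ᵥ M.v i ω)
    + (M.Ur ω * M.D i * M.Sig * (M.Vr ω)ᵀ * (M.Z ω)ᵀ) *ᵥ M.u i ω

/-- `Δu_i^c = d_i⁻¹ U_c U_cᵀ Z v_i`. -/
def duC (M : SpikedModel τ ν r p n P) (i : Fin r) (ω : Ω) : Fin p → ℝ :=
  (M.d i)⁻¹ • ((M.Uc ω * (M.Uc ω)ᵀ * M.Z ω) *ᵥ M.v i ω)

/-- `Δv_i^r = d_i V_r D_i V_rᵀ Zᵀ u_i + V_r D_i Σ_r U_rᵀ Z v_i`. -/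
def dvR (M : SpikedModel τ ν r p n P) (i : Fin r) (ω : Ω) : Fin n → ℝ :=
  M.d i • ((M.Vr ω * M.D i * (M.Vr ω)ᵀ * (M.Z ω)ᵀ) *ᵥ M.u i ω)
    + (M.Vr ω * M.D i * M.Sig * (M.Ur ω)ᵀ * M.Z ω) *ᵥ M.v i ω

/-- `Δv_i^c = d_i⁻¹ V_c V_cᵀ Zᵀ u_i`. -/
def dvC (M : SpikedModel τ ν r p n P) (i : Fin r) (ω : Ω) : Fin n → ℝ :=
  (M.d i)⁻¹ • ((M.Vc ω * (M.Vc ω)ᵀ * (M.Z ω)ᵀ) *ᵥ M.u i ω)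

/-- The first-order perturbation `Δu_i = Δu_i^r + Δu_i^c` of the left singular vector `u_i`. -/
def du (M : SpikedModel τ ν r p n P) (i : Fin r) (ω : Ω) : Fin p → ℝ := M.duR i ω + M.duC i ω

/-- The first-order perturbation `Δv_i = Δv_i^r + Δv_i^c` of the right singular vector `v_i`. -/
def dv (M : SpikedModel τ ν r p n P) (i : Fin r) (ω : Ω) : Fin n → ℝ := M.dvR i ω + M.dvC i ω

end SpikedModel

end

noncomputable section

/-! Every entry of the two components of a perturbation is a linear form in `X` whose coefficient
matrix depends only on `(U_r, V_r)`, hence is independent of `X` (`signalCoef_sum`,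
`noiseCoef_sum`). The entries of `X` are centred, uncorrelated and of variance `1/n`, so each second
moment or cross moment is `1/n` times the expected inner product of coefficient matrices
(`integral_sum_mul_sum`).

Write `S`, `T` for the square roots of the two covariances. The coefficients are sums of at most two
rank-one matrices. For the noise component, the squared norm is bounded by a constant, which gives
`C/n`. For the signal component, the coefficients are linear in the `a`-th row of `U_r`, so the
squared norm is `O(|U_rᵀ e_a|²)`. Cauchy–Schwarz on the cross moment would only give `n^{-3/2}`;
instead its inner product is bounded directly by `|U_rᵀ e_a|² + |U_rᵀ S² e_a|²`
(`abs_sum_signalCoef_mul_noiseCoef_le`).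

Everything thus reduces to delocalization: `E (x·u_j)² ≤ C |x|²/m` for a fixed vector `x` and a QR
column `u_j`, `j ≤ r` (`integral_qr_col_sq_le`). If the Gram matrix of the first `r` columns `G_r`
of `G` is at least `m/4`, then `u_j = G_r y` with `|y|² ≤ 4/m`, so `(x·u_j)² ≤ (4/m) |G_rᵀ x|²`,
which has expectation `O(|x|²/m)`. Otherwise `(x·u_j)² ≤ |x|²`, and Chebyshev gives this event
probability `O(1/m)`. Truncating the squared entries makes second moments of `ν` sufficient.

The right singular vectors are handled by the same argument applied to the transposed noise. -/

/-! ### Linear forms in uncorrelated variables with independent random coefficients. -/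

theorem memLp_sum_mul_of_bounded {ι E Ω : Type*} [Fintype ι] [MeasurableSpace E]
    [MeasurableSpace Ω] {P : Measure Ω} {Y : ι → Ω → ℝ} {W : Ω → E}
    (hY : ∀ s, MemLp (Y s) 2 P) (hW : AEMeasurable W P)
    {c : ι → E → ℝ} (hc : ∀ s, Measurable (c s)) {K : ℝ} (hK : ∀ s ω, |c s (W ω)| ≤ K) :
    MemLp (fun ω => ∑ s, c s (W ω) * Y s ω) 2 P := by
  refine memLp_finsetSum _ fun s _ => ?_
  refine MemLp.of_le_mul (c := K) (hY s) ?_ (Filter.Eventually.of_forall fun ω => ?_)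
  · exact (((hc s).comp_aemeasurable hW).aestronglyMeasurable).mul (hY s).1
  · rw [norm_mul]
    exact mul_le_mul_of_nonneg_right (hK s ω) (norm_nonneg _)

/-- Expand into a double sum. Independence of `W` from the whole family `Y` factors each term, and
uncorrelatedness leaves only the diagonal. Bounded coefficients are enough for integrability. -/
theorem integral_sum_mul_sum {ι E Ω : Type*} [Fintype ι] [DecidableEq ι] [MeasurableSpace E]
    [MeasurableSpace Ω] {P : Measure Ω} [IsProbabilityMeasure P] {Y : ι → Ω → ℝ} {W : Ω → E} {σ : ℝ}
    (hY : ∀ s, MemLp (Y s) 2 P)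
    (hcov : ∀ s t, ∫ ω, Y s ω * Y t ω ∂P = if s = t then σ else 0)
    (hW : AEMeasurable W P) (hind : IndepFun W (fun ω s => Y s ω) P)
    {c c' : ι → E → ℝ} (hc : ∀ s, Measurable (c s)) (hc' : ∀ s, Measurable (c' s))
    {K K' : ℝ} (hK : ∀ s ω, |c s (W ω)| ≤ K) (hK' : ∀ s ω, |c' s (W ω)| ≤ K') :
    ∫ ω, (∑ s, c s (W ω) * Y s ω) * (∑ s, c' s (W ω) * Y s ω) ∂P
      = σ * ∫ ω, ∑ s, c s (W ω) * c' s (W ω) ∂P := by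
  have hYm : ∀ s, AEMeasurable (Y s) P := fun s => (hY s).1.aemeasurable
  have hint : ∀ s t, Integrable (fun ω => (c s (W ω) * c' t (W ω)) * (Y s ω * Y t ω)) P := by
    intro s t
    refine Integrable.bdd_mul (c := K * K') ((hY s).integrable_mul (hY t)) ?_ ?_
    · exact (((hc s).mul (hc' t)).comp_aemeasurable hW).aestronglyMeasurable
    · refine Filter.Eventually.of_forall fun ω => ?_
      rw [norm_mul]
      exact mul_le_mul (hK s ω) (hK' t ω) (norm_nonneg _) ((abs_nonneg _).trans (hK s ω))
  have hcc : ∀ s, Integrable (fun ω => c s (W ω) * c' s (W ω)) P := by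
    intro s
    refine Integrable.of_bound (((hc s).mul (hc' s)).comp_aemeasurable hW).aestronglyMeasurable
      (K * K') (Filter.Eventually.of_forall fun ω => ?_)
    change ‖c s (W ω) * c' s (W ω)‖ ≤ _
    rw [norm_mul]
    exact mul_le_mul (hK s ω) (hK' s ω) (norm_nonneg _) ((abs_nonneg _).trans (hK s ω))
  have hone : ∀ s t, ∫ ω, (c s (W ω) * c' t (W ω)) * (Y s ω * Y t ω) ∂P
      = (∫ ω, c s (W ω) * c' t (W ω) ∂P) * if s = t then σ else 0 := by
    intro s t
    rw [← hcov s t]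
    exact hind.integral_fun_comp_mul_comp (f := fun e => c s e * c' t e)
      (g := fun y : ι → ℝ => y s * y t) hW (aemeasurable_pi_lambda _ hYm)
      ((hc s).mul (hc' t)).aestronglyMeasurable
      ((measurable_pi_apply s).mul (measurable_pi_apply t)).aestronglyMeasurable
  have hexp : ∀ ω, (∑ s, c s (W ω) * Y s ω) * (∑ s, c' s (W ω) * Y s ω)
      = ∑ s, ∑ t, (c s (W ω) * c' t (W ω)) * (Y s ω * Y t ω) := by
    intro ω
    rw [Finset.sum_mul_sum]
    exact Finset.sum_congr rfl fun s _ => Finset.sum_congr rfl fun t _ => by ring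
  simp_rw [hexp]
  rw [integral_finsetSum _ fun s _ => integrable_finsetSum _ fun t _ => hint s t,
    integral_finsetSum _ fun s _ => hcc s, Finset.mul_sum]
  refine Finset.sum_congr rfl fun s _ => ?_
  rw [integral_finsetSum _ fun t _ => hint s t]
  rw [Finset.sum_congr rfl fun t _ => hone s t]
  simp [mul_comm]

theorem integral_sum_mul_sq {ι Ω : Type*} [Fintype ι] [DecidableEq ι]
    [MeasurableSpace Ω] {P : Measure Ω} [IsProbabilityMeasure P] {Y : ι → Ω → ℝ} {σ : ℝ}
    (hY : ∀ s, MemLp (Y s) 2 P)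
    (hcov : ∀ s t, ∫ ω, Y s ω * Y t ω ∂P = if s = t then σ else 0) (x : ι → ℝ) :
    ∫ ω, (∑ s, x s * Y s ω) ^ 2 ∂P = σ * ∑ s, x s ^ 2 := by
  have hx : ∀ s (_ : Ω), |x s| ≤ ∑ t, |x t| := fun s _ =>
    Finset.single_le_sum (f := fun t => |x t|) (fun t _ => abs_nonneg _) (Finset.mem_univ s)
  -- Deterministic coefficients are the case of a constant `W`, which is independent of anything.
  have := integral_sum_mul_sum (W := fun _ : Ω => ()) (c := fun s _ => x s) (c' := fun s _ => x s)
    hY hcov aemeasurable_const (indepFun_const_left () _) (fun _ => measurable_const)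
    (fun _ => measurable_const) hx hx
  simpa [sq] using this

/-! ### Delocalization of the columns of a QR factor. -/

/-- Truncated squares have finite variance without a fourth moment of `ν`, so Chebyshev applies to
their sums. The value `3/4` lies below the variance `1` and leaves a margin of `1/4` over the
threshold `1/2` used for the column norms. -/
theorem exists_truncated_moment (ν : Measure ℝ) [IsProbabilityMeasure ν]
    (hν_sq : Integrable (fun x : ℝ => x ^ 2) ν) (hν_var : ∫ x, x ^ 2 ∂ν = 1) :
    ∃ K : ℕ, 3 / 4 ≤ ∫ x : ℝ, min (x ^ 2) (K : ℝ) ∂ν := by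
  have h : Filter.Tendsto (fun K : ℕ => ∫ x : ℝ, min (x ^ 2) (K : ℝ) ∂ν) Filter.atTop
      (nhds (∫ x, x ^ 2 ∂ν)) := by
    refine tendsto_integral_of_dominated_convergence (fun x => x ^ 2) (fun K => ?_) hν_sq
      (fun K => Filter.Eventually.of_forall fun x => ?_)
      (Filter.Eventually.of_forall fun x => ?_)
    · exact (by fun_prop : Measurable fun x : ℝ => min (x ^ 2) (K : ℝ)).aestronglyMeasurable
    · rw [Real.norm_of_nonneg (le_min (sq_nonneg x) K.cast_nonneg)]
      exact min_le_left _ _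
    · refine tendsto_const_nhds.congr' ?_
      filter_upwards [Filter.eventually_ge_atTop ⌈x ^ 2⌉₊] with K hK
      exact (min_eq_left (Nat.ceil_le.mp hK)).symm
  rw [hν_var] at h
  exact (h.eventually_const_le (by norm_num : (3 / 4 : ℝ) < 1)).exists

theorem dotProduct_sq_le {ι : Type*} [Fintype ι] (x y : ι → ℝ) :
    (x ⬝ᵥ y) ^ 2 ≤ (x ⬝ᵥ x) * (y ⬝ᵥ y) := by
  simpa [dotProduct, sq] using Finset.sum_mul_sq_le_sq_mul_sq Finset.univ x y

theorem orthogonal_col_dotProduct_self {m : ℕ} {Q : Matrix (Fin m) (Fin m) ℝ}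
    (hQ : Q ∈ orthogonalGroup (Fin m) ℝ) (k : Fin m) :
    (fun a => Q a k) ⬝ᵥ (fun a => Q a k) = 1 := by
  have := congrFun (congrFun ((mem_orthogonalGroup_iff' _ _).mp hQ) k) k
  simpa [mul_apply, star_apply, dotProduct] using this

/-- Triangularity restricts `G = QR` to `G_r = Q_r R_r`, and the Gram bound makes `R_r` invertible.
So the column is `G_r y` with `R_r y = e_j`. As it has norm one, the Gram bound gives `|y|² ≤ 4/m`,
and Cauchy–Schwarz on `(G_rᵀ x)·y` concludes. -/
theorem sq_dotProduct_qr_col_le {m r : ℕ} (hm : 0 < m) (hr : r ≤ m)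
    {G Q : Matrix (Fin m) (Fin m) ℝ} (hQ : Q ∈ orthogonalGroup (Fin m) ℝ)
    (hR : (Qᵀ * G).BlockTriangular id) (x : Fin m → ℝ) (j : Fin r)
    (hgood : ∀ y : Fin r → ℝ, (m / 4 : ℝ) * (y ⬝ᵥ y) ≤
      (G.submatrix id (Fin.castLE hr) *ᵥ y) ⬝ᵥ (G.submatrix id (Fin.castLE hr) *ᵥ y)) :
    (x ⬝ᵥ fun a => Q a (Fin.castLE hr j)) ^ 2 ≤
      4 / m * ∑ k : Fin r, (∑ a, x a * G a (Fin.castLE hr k)) ^ 2 := by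
  set Gr := G.submatrix id (Fin.castLE hr) with hGr
  set Qr := Q.submatrix id (Fin.castLE hr) with hQr
  set R := Qᵀ * G with hRdef
  set Rr := R.submatrix (Fin.castLE hr) (Fin.castLE hr) with hRr
  have hm' : (0 : ℝ) < m := by exact_mod_cast hm
  have hQR : G = Q * R := by
    rw [hRdef, ← Matrix.mul_assoc, mem_orthogonalGroup_iff _ _ |>.mp hQ, Matrix.one_mul]
  have hGQ : Gr = Qr * Rr := by
    ext a k
    have : Gr a k = ∑ b, Q a b * R b (Fin.castLE hr k) := by
      rw [hGr, submatrix_apply, hQR, mul_apply]; rfl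
    rw [this, mul_apply]
    -- The indices `b` outside the first `r` satisfy `k < r ≤ b`, so `R b k` lies below the diagonal
    -- and vanishes.
    refine (Finset.sum_of_injOn (Fin.castLE hr) (Fin.castLE_injective hr).injOn
      (by simp) (fun b _ hb => ?_) (fun b _ => rfl)).symm
    have hb' : (k : ℕ) < b := by
      by_contra hlt
      exact hb ⟨⟨b, by omega⟩, by simp, by ext; simp⟩
    rw [hR (show id (Fin.castLE hr k) < id b from hb'), mul_zero]
  have hinj : Function.Injective Rr.mulVec := by
    refine (injective_iff_map_eq_zero (Matrix.mulVecLin Rr)).mpr fun y hy => ?_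
    have hy : Rr *ᵥ y = 0 := hy
    have h := hgood y
    rw [hGQ, ← mulVec_mulVec, hy, mulVec_zero, dotProduct_zero] at h
    have h0 : y ⬝ᵥ y = 0 := le_antisymm (nonpos_of_mul_nonpos_right h (by positivity))
      (Finset.sum_nonneg fun i _ => mul_self_nonneg _)
    exact dotProduct_self_eq_zero.mp h0
  obtain ⟨y, hy⟩ := (mulVec_surjective_iff_isUnit.mpr (mulVec_injective_iff_isUnit.mp hinj))
    (Pi.single j 1)
  have hGy : Gr *ᵥ y = fun a => Q a (Fin.castLE hr j) := by
    rw [hGQ, ← mulVec_mulVec, hy, mulVec_single_one]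
    rfl
  have hone := orthogonal_col_dotProduct_self hQ (Fin.castLE hr j)
  have hyy : y ⬝ᵥ y ≤ 4 / m := by
    have h := hgood y
    rw [hGy, hone] at h
    rw [le_div_iff₀ hm']
    linarith
  calc (x ⬝ᵥ fun a => Q a (Fin.castLE hr j)) ^ 2 = ((x ᵥ* Gr) ⬝ᵥ y) ^ 2 := by
        rw [← hGy, dotProduct_mulVec]
    _ ≤ ((x ᵥ* Gr) ⬝ᵥ (x ᵥ* Gr)) * (y ⬝ᵥ y) := dotProduct_sq_le _ _
    _ ≤ ((x ᵥ* Gr) ⬝ᵥ (x ᵥ* Gr)) * (4 / m) :=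
        mul_le_mul_of_nonneg_left hyy (Finset.sum_nonneg fun i _ => mul_self_nonneg _)
    _ = _ := by
        rw [mul_comm]
        congr 1
        simp only [vecMul, dotProduct, sq]
        rfl

/-- Diagonal dominance: the off-diagonal part costs at most `m/(4r) (∑ |y_k|)² ≤ (m/4)|y|²`, half of
what the diagonal provides. -/
theorem gram_lower_bound {m r : ℕ} (hr : 0 < r) {g : Fin m → Fin r → ℝ}
    (hdiag : ∀ k, (m / 2 : ℝ) ≤ ∑ a, g a k ^ 2)
    (hoff : ∀ k l, k ≠ l → |∑ a, g a k * g a l| ≤ m / (4 * r)) (y : Fin r → ℝ) :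
    (m / 4 : ℝ) * (y ⬝ᵥ y) ≤ (Matrix.of g *ᵥ y) ⬝ᵥ (Matrix.of g *ᵥ y) := by
  have hexp : (Matrix.of g *ᵥ y) ⬝ᵥ (Matrix.of g *ᵥ y)
      = ∑ k, ∑ l, y k * y l * ∑ a, g a k * g a l := by
    simp only [mulVec, dotProduct, of_apply]
    simp_rw [Finset.sum_mul_sum, Finset.mul_sum]
    rw [Finset.sum_comm]
    refine Finset.sum_congr rfl fun k _ => ?_
    rw [Finset.sum_comm]
    exact Finset.sum_congr rfl fun l _ => Finset.sum_congr rfl fun a _ => by ring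
  -- The penalty is subtracted on the diagonal too, which is wasteful but makes the double sum
  -- factor as `(∑ |y_k|)²`.
  have hterm : ∀ k l, (if k = l then (m / 2 : ℝ) * y k ^ 2 else 0) - m / (4 * r) * (|y k| * |y l|)
      ≤ y k * y l * ∑ a, g a k * g a l := by
    intro k l
    have hnn : (0 : ℝ) ≤ m / (4 * r) * (|y k| * |y l|) := by positivity
    split_ifs with h
    · subst h
      have := mul_le_mul_of_nonneg_left (hdiag k) (sq_nonneg (y k))
      simp only [← sq]
      linarith
    · have h1 : |y k * y l * ∑ a, g a k * g a l| ≤ m / (4 * r) * (|y k| * |y l|) := by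
        rw [abs_mul, abs_mul, mul_comm]
        exact mul_le_mul_of_nonneg_right (hoff k l h) (by positivity)
      linarith [neg_abs_le (y k * y l * ∑ a, g a k * g a l)]
  have hcs : (∑ k, |y k|) ^ 2 ≤ r * ∑ k, y k ^ 2 := by
    simpa using sq_sum_le_card_mul_sum_sq (s := Finset.univ) (f := fun k => |y k|)
  have hr' : (0 : ℝ) < r := by exact_mod_cast hr
  have hsum := Finset.sum_le_sum fun k (_ : k ∈ Finset.univ) =>
    Finset.sum_le_sum fun l (_ : l ∈ Finset.univ) => hterm k l
  rw [← hexp] at hsum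
  refine le_trans ?_ hsum
  simp only [Finset.sum_sub_distrib, Finset.sum_ite_eq, Finset.mem_univ, if_true,
    ← Finset.mul_sum, ← Finset.sum_mul]
  have hyy : y ⬝ᵥ y = ∑ k, y k ^ 2 := by simp [dotProduct, sq]
  rw [hyy, ← sq]
  have : (m : ℝ) / (4 * r) * (∑ k, |y k|) ^ 2 ≤ m / (4 * r) * (r * ∑ k, y k ^ 2) :=
    mul_le_mul_of_nonneg_left hcs (by positivity)
  have h2 : (m : ℝ) / (4 * r) * (r * ∑ k, y k ^ 2) = m / 4 * ∑ k, y k ^ 2 := by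
    field_simp
  linarith

/-- Chebyshev's inequality in pointwise form: the factor of `x ⬝ᵥ x` is at least `1` whenever the
Gram bound's hypotheses fail, so no event has to be introduced. The factors `16/m²` and `16r²/m²`
are the inverse squares of the deviations `m/4` and `m/(4r)`. -/
theorem sq_dotProduct_qr_col_le_add {m r : ℕ} (hm : 0 < m) (hr : r ≤ m)
    {G Q : Matrix (Fin m) (Fin m) ℝ} (hQ : Q ∈ orthogonalGroup (Fin m) ℝ)
    (hR : (Qᵀ * G).BlockTriangular id) (x : Fin m → ℝ) (j : Fin r) {h : ℝ → ℝ} {μ : ℝ}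
    (hh : ∀ t, h t ≤ t ^ 2) (hμ : 3 / 4 ≤ μ) :
    (x ⬝ᵥ fun a => Q a (Fin.castLE hr j)) ^ 2 ≤
      4 / m * ∑ k : Fin r, (∑ a, x a * G a (Fin.castLE hr k)) ^ 2
      + (x ⬝ᵥ x) * (16 / m ^ 2 * ∑ k : Fin r, (∑ a, (h (G a (Fin.castLE hr k)) - μ)) ^ 2
        + 16 * r ^ 2 / m ^ 2 * ∑ k : Fin r, ∑ l : Fin r, if k = l then 0 else
          (∑ a, G a (Fin.castLE hr k) * G a (Fin.castLE hr l)) ^ 2) := by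
  have hm' : (0 : ℝ) < m := by exact_mod_cast hm
  have hr0 : 0 < r := j.pos
  have hr' : (0 : ℝ) < r := by exact_mod_cast hr0
  set A := ∑ k : Fin r, (∑ a, x a * G a (Fin.castLE hr k)) ^ 2
  set B := fun k : Fin r => (∑ a, (h (G a (Fin.castLE hr k)) - μ)) ^ 2 with hB
  set D := fun k l : Fin r => if k = l then 0 else
          (∑ a, G a (Fin.castLE hr k) * G a (Fin.castLE hr l)) ^ 2 with hD
  have hA0 : 0 ≤ A := Finset.sum_nonneg fun k _ => sq_nonneg _
  have hB0 : ∀ k, 0 ≤ B k := fun k => sq_nonneg _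
  have hD0 : ∀ k l, 0 ≤ D k l := fun k l => by
    simp only [hD]; split_ifs; exacts [le_rfl, sq_nonneg _]
  have hx0 : 0 ≤ x ⬝ᵥ x := Finset.sum_nonneg fun i _ => mul_self_nonneg _
  change _ ≤ 4 / m * A + (x ⬝ᵥ x) * (16 / m ^ 2 * ∑ k, B k + 16 * r ^ 2 / m ^ 2 * ∑ k, ∑ l, D k l)
  have hSB : 0 ≤ ∑ k, B k := Finset.sum_nonneg fun k _ => hB0 k
  have hSD' : ∀ k, 0 ≤ ∑ l, D k l := fun k => Finset.sum_nonneg fun l _ => hD0 k l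
  have hSD : 0 ≤ ∑ k, ∑ l, D k l := Finset.sum_nonneg fun k _ => hSD' k
  by_cases hgood : (∀ k : Fin r, (m / 2 : ℝ) ≤ ∑ a, G a (Fin.castLE hr k) ^ 2) ∧
      ∀ k l : Fin r, k ≠ l →
        |∑ a, G a (Fin.castLE hr k) * G a (Fin.castLE hr l)| ≤ m / (4 * r)
  · have h1 := sq_dotProduct_qr_col_le hm hr hQ hR x j
      (gram_lower_bound (g := fun a k => G a (Fin.castLE hr k)) hr0 hgood.1 hgood.2)
    have : 0 ≤ (x ⬝ᵥ x) * (16 / m ^ 2 * ∑ k, B k + 16 * r ^ 2 / m ^ 2 * ∑ k, ∑ l, D k l) := by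
      positivity
    linarith
  · have hone := orthogonal_col_dotProduct_self hQ (Fin.castLE hr j)
    have h1 := dotProduct_sq_le x (fun a => Q a (Fin.castLE hr j))
    rw [hone, mul_one] at h1
    suffices hbad : 1 ≤ 16 / m ^ 2 * ∑ k, B k + 16 * r ^ 2 / m ^ 2 * ∑ k, ∑ l, D k l by
      have := mul_le_mul_of_nonneg_left hbad hx0
      have : 0 ≤ 4 / m * A := by positivity
      linarith
    have hT1 : 0 ≤ 16 / m ^ 2 * ∑ k, B k := by positivity
    have hT2 : 0 ≤ 16 * (r : ℝ) ^ 2 / m ^ 2 * ∑ k, ∑ l, D k l := by positivity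
    rw [not_and_or] at hgood
    push Not at hgood
    rcases hgood with ⟨k, hk⟩ | ⟨k, l, hkl, hk⟩
    -- A column with squared norm below `m/2` has truncated sum below `m/2`, hence at least `m/4`
    -- below its mean `μ m ≥ 3m/4`.
    · have hle : ∑ a, (h (G a (Fin.castLE hr k)) - μ) ≤ - (m / 4) := by
        have e1 : ∑ a, h (G a (Fin.castLE hr k)) ≤ ∑ a, G a (Fin.castLE hr k) ^ 2 :=
          Finset.sum_le_sum fun a _ => hh _
        have e2 : (3 / 4 : ℝ) * m ≤ μ * m := mul_le_mul_of_nonneg_right hμ hm'.le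
        simp only [Finset.sum_sub_distrib, Finset.sum_const, Finset.card_univ, Fintype.card_fin,
          nsmul_eq_mul]
        linarith
      have hBk : (m / 4 : ℝ) ^ 2 ≤ B k := by
        rw [hB]
        exact sq_le_sq' (by linarith) (by linarith) |>.trans_eq (neg_sq _)
      have hBs : B k ≤ ∑ k, B k := Finset.single_le_sum (fun k _ => hB0 k) (Finset.mem_univ k)
      have : 16 / (m : ℝ) ^ 2 * (m / 4) ^ 2 ≤ 16 / m ^ 2 * ∑ k, B k :=
        mul_le_mul_of_nonneg_left (hBk.trans hBs) (by positivity)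
      have e : 16 / (m : ℝ) ^ 2 * (m / 4) ^ 2 = 1 := by field_simp; norm_num
      linarith
    · have hDk : (m / (4 * r) : ℝ) ^ 2 ≤ D k l := by
        simp only [hD, if_neg hkl]
        rw [← sq_abs (∑ a, _)]
        exact pow_le_pow_left₀ (by positivity) hk.le 2
      have hDs : D k l ≤ ∑ k, ∑ l, D k l :=
        (Finset.single_le_sum (fun l _ => hD0 k l) (Finset.mem_univ l)).trans
          (Finset.single_le_sum (f := fun k => ∑ l, D k l) (fun k _ => hSD' k) (Finset.mem_univ k))
      have : 16 * (r : ℝ) ^ 2 / m ^ 2 * (m / (4 * r)) ^ 2 ≤ 16 * r ^ 2 / m ^ 2 * ∑ k, ∑ l, D k l :=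
        mul_le_mul_of_nonneg_left (hDk.trans hDs) (by positivity)
      have e : 16 * (r : ℝ) ^ 2 / m ^ 2 * (m / (4 * r)) ^ 2 = 1 := by field_simp; norm_num
      linarith

theorem integral_mul_eq_ite_of_indepFun {ι Ω : Type*} [DecidableEq ι]
    [MeasurableSpace Ω] {P : Measure Ω} {Y : ι → Ω → ℝ} {σ : ℝ}
    (hY : ∀ s, MemLp (Y s) 2 P) (hind : ∀ s t, s ≠ t → IndepFun (Y s) (Y t) P)
    (hmean : ∀ s, ∫ ω, Y s ω ∂P = 0) (hvar : ∀ s, ∫ ω, Y s ω ^ 2 ∂P = σ) (s t : ι) :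
    ∫ ω, Y s ω * Y t ω ∂P = if s = t then σ else 0 := by
  split_ifs with h
  · subst h
    simp only [← sq, hvar]
  · rw [(hind s t h).integral_fun_mul_eq_mul_integral (hY s).1 (hY t).1, hmean s, zero_mul]

/-- Each sum in the pointwise bound has pairwise independent centred terms, so its second moment is
linear in `m`; divided by `m²` this is `O(1/m)`. The three summands of the constant come from the
linear statistics, the truncated squares and the off-diagonal Gram entries. -/
theorem integral_qr_col_sq_le {m r K : ℕ} (hm : 0 < m) (hr : r ≤ m)
    {ν : Measure ℝ} [IsProbabilityMeasure ν]
    (hν_sq : Integrable (fun x : ℝ => x ^ 2) ν) (hν_mean : ∫ x, x ∂ν = 0)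
    (hν_var : ∫ x, x ^ 2 ∂ν = 1) (hK : 3 / 4 ≤ ∫ x : ℝ, min (x ^ 2) (K : ℝ) ∂ν)
    {Ω : Type*} [MeasurableSpace Ω] {P : Measure Ω} [IsProbabilityMeasure P]
    {G : Ω → Matrix (Fin m) (Fin m) ℝ} (hlaw : ∀ j k, HasLaw (fun ω => G ω j k) ν P)
    (hind : iIndepFun (fun (s : Fin m × Fin m) ω => G ω s.1 s.2) P)
    {Q : Matrix (Fin m) (Fin m) ℝ → Matrix (Fin m) (Fin m) ℝ} (hQ : IsQRFactor Q)
    (x : Fin m → ℝ) (j : Fin r) :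
    ∫ ω, (x ⬝ᵥ fun a => Q (G ω) a (Fin.castLE hr j)) ^ 2 ∂P
      ≤ (4 * r + 16 * r * (K : ℝ) ^ 2 + 16 * r ^ 4) * (x ⬝ᵥ x) / m := by
  have hm' : (0 : ℝ) < m := by exact_mod_cast hm
  set μ := ∫ x : ℝ, min (x ^ 2) (K : ℝ) ∂ν with hμ
  have hGm : ∀ s : Fin m × Fin m, AEMeasurable (fun ω => G ω s.1 s.2) P :=
    fun s => (hlaw s.1 s.2).aemeasurable
  have hcomp : ∀ (f : ℝ → ℝ), Measurable f → ∀ a k, ∫ ω, f (G ω a k) ∂P = ∫ t, f t ∂ν :=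
    fun f hf a k => (hlaw a k).integral_comp hf.aestronglyMeasurable
  have hGint : ∀ a k, Integrable (fun ω => G ω a k ^ 2) P := by
    intro a k
    have : Integrable (fun t : ℝ => t ^ 2) (P.map fun ω => G ω a k) := by
      rw [(hlaw a k).map_eq]; exact hν_sq
    exact this.comp_aemeasurable (hlaw a k).aemeasurable
  have hGL : ∀ a k, MemLp (fun ω => G ω a k) 2 P := fun a k =>
    (memLp_two_iff_integrable_sq (hlaw a k).aemeasurable.aestronglyMeasurable).mpr (hGint a k)
  have hGmean : ∀ a k, ∫ ω, G ω a k ∂P = 0 := fun a k =>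
    (hcomp (fun t => t) measurable_id a k).trans hν_mean
  have hGvar : ∀ a k, ∫ ω, G ω a k ^ 2 ∂P = 1 := fun a k =>
    (hcomp (fun t => t ^ 2) (by fun_prop) a k).trans hν_var
  have hGind : ∀ a k b l, (a, k) ≠ (b, l) →
      IndepFun (fun ω => G ω a k) (fun ω => G ω b l) P := fun a k b l h => hind.indepFun h
  -- the linear statistics
  have hA : ∀ k, ∫ ω, (∑ a, x a * G ω a k) ^ 2 ∂P = 1 * ∑ a, x a ^ 2 := fun k =>
    integral_sum_mul_sq (fun a => hGL a k)
      (integral_mul_eq_ite_of_indepFun (fun a => hGL a k)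
        (fun a b h => hGind a k b k (by simpa using h)) (fun a => hGmean a k)
        (fun a => hGvar a k)) x
  -- the truncated squares
  set h : ℝ → ℝ := fun t => min (t ^ 2) (K : ℝ) with hh
  have hhm : Measurable h := by fun_prop
  have hh0 : ∀ t, 0 ≤ h t := fun t => le_min (sq_nonneg t) K.cast_nonneg
  have hhK : ∀ t, h t ≤ K := fun t => min_le_right _ _
  have hhint : Integrable h ν := Integrable.of_bound hhm.aestronglyMeasurable K
    (Filter.Eventually.of_forall fun t => by rw [Real.norm_of_nonneg (hh0 t)]; exact hhK t)
  have hμ0 : 0 ≤ μ := integral_nonneg hh0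
  have hμK : μ ≤ K := by
    calc μ ≤ ∫ _, (K : ℝ) ∂ν := integral_mono hhint (integrable_const _) hhK
      _ = K := by simp
  have hdev : ∀ t, |h t - μ| ≤ K := fun t =>
    abs_sub_le_iff.mpr ⟨by linarith [hhK t], by linarith [hh0 t]⟩
  have hBL : ∀ k a, MemLp (fun ω => h (G ω a k) - μ) 2 P := fun k a =>
    MemLp.of_bound ((hhm.sub_const μ).comp_aemeasurable (hGm (a, k))).aestronglyMeasurable K
      (Filter.Eventually.of_forall fun ω => hdev _)
  set σ := ∫ t, (h t - μ) ^ 2 ∂ν with hσ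
  have hσK : σ ≤ (K : ℝ) ^ 2 := by
    have hle : ∀ t, (h t - μ) ^ 2 ≤ (K : ℝ) ^ 2 := fun t =>
      sq_le_sq' (abs_le.mp (hdev t)).1 (abs_le.mp (hdev t)).2
    calc σ ≤ ∫ _, (K : ℝ) ^ 2 ∂ν := integral_mono_of_nonneg
          (Filter.Eventually.of_forall fun t => sq_nonneg _) (integrable_const _)
          (Filter.Eventually.of_forall hle)
      _ = _ := by simp
  have hB : ∀ k, ∫ ω, (∑ a, (h (G ω a k) - μ)) ^ 2 ∂P = σ * m := by
    intro k
    have := integral_sum_mul_sq (hBL k) (integral_mul_eq_ite_of_indepFun (σ := σ) (hBL k)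
      (fun a b hab => (hGind a k b k (by simpa using hab)).comp
        (hhm.sub_const μ) (hhm.sub_const μ))
      (fun a => by
        rw [hcomp (fun t => h t - μ) (hhm.sub_const μ) a k, integral_sub hhint (integrable_const _)]
        simp [hμ, hh])
      (fun a => hcomp (fun t => (h t - μ) ^ 2) ((hhm.sub_const μ).pow_const 2) a k)) 1
    simpa using this
  -- the off-diagonal products
  have hDint : ∀ a k l, k ≠ l → Integrable (fun ω => (G ω a k * G ω a l) ^ 2) P := by
    intro a k l hkl
    have := ((hGind a k a l (by simpa using hkl)).comp (measurable_id.pow_const 2)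
      (measurable_id.pow_const 2)).integrable_mul (hGint a k) (hGint a l)
    exact this.congr (Filter.Eventually.of_forall fun ω => (mul_pow _ _ 2).symm)
  have hDL : ∀ k l, k ≠ l → ∀ a, MemLp (fun ω => G ω a k * G ω a l) 2 P := fun k l hkl a =>
    (memLp_two_iff_integrable_sq ((hGm (a, k)).mul (hGm (a, l))).aestronglyMeasurable).mpr
      (hDint a k l hkl)
  have hD : ∀ k l, k ≠ l → ∫ ω, (∑ a, G ω a k * G ω a l) ^ 2 ∂P = m := by
    intro k l hkl
    -- Products from different rows involve four distinct entries of `G`, hence are independent.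
    have := integral_sum_mul_sq (hDL k l hkl) (integral_mul_eq_ite_of_indepFun (σ := 1) (hDL k l hkl)
      (fun a b hab => hind.indepFun_mul_mul₀ hGm (a, k) (a, l) (b, k) (b, l) (by simp [hab])
        (by simp [hab]) (by simp [hab]) (by simp [hab]))
      (fun a => by
        rw [(hGind a k a l (by simpa using hkl)).integral_fun_mul_eq_mul_integral (hGL a k).1
          (hGL a l).1, hGmean, zero_mul])
      (fun a => by
        have hi : IndepFun (fun ω => G ω a k ^ 2) (fun ω => G ω a l ^ 2) P :=
          (hGind a k a l (by simpa using hkl)).comp (measurable_id.pow_const 2)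
            (measurable_id.pow_const 2)
        simp_rw [mul_pow]
        rw [hi.integral_fun_mul_eq_mul_integral (hGint a k).1 (hGint a l).1]
        change (∫ ω, G ω a k ^ 2 ∂P) * (∫ ω, G ω a l ^ 2 ∂P) = 1
        rw [hGvar, hGvar, one_mul])) 1
    simpa using this
  -- integrate the pointwise bound
  have iA : ∀ k, Integrable (fun ω => (∑ a, x a * G ω a k) ^ 2) P := fun k =>
    (memLp_finsetSum _ fun a _ => (hGL a k).const_mul (x a)).integrable_sq
  have iB : ∀ k, Integrable (fun ω => (∑ a, (h (G ω a k) - μ)) ^ 2) P := fun k =>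
    (memLp_finsetSum _ fun a _ => hBL k a).integrable_sq
  have iD : ∀ k l : Fin r, Integrable (fun ω => if k = l then 0 else
      (∑ a, G ω a (Fin.castLE hr k) * G ω a (Fin.castLE hr l)) ^ 2) P := fun k l => by
    split_ifs with hkl
    · exact integrable_zero _ _ _
    · exact (memLp_finsetSum _ fun a _ => hDL _ _
        (fun e => hkl (Fin.castLE_injective hr e)) a).integrable_sq
  have vD : ∀ k l : Fin r, ∫ ω, (if k = l then 0 else
      (∑ a, G ω a (Fin.castLE hr k) * G ω a (Fin.castLE hr l)) ^ 2) ∂P ≤ m := fun k l => by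
    split_ifs with hkl
    · simp
    · exact (hD _ _ (fun e => hkl (Fin.castLE_injective hr e))).le
  have isA := (integrable_finsetSum Finset.univ
    fun (k : Fin r) _ => iA (Fin.castLE hr k)).const_mul (4 / (m : ℝ))
  have isB := (integrable_finsetSum Finset.univ
    fun (k : Fin r) _ => iB (Fin.castLE hr k)).const_mul (16 / (m : ℝ) ^ 2)
  have isD := (integrable_finsetSum Finset.univ fun (k : Fin r) _ =>
    integrable_finsetSum Finset.univ fun (l : Fin r) _ => iD k l).const_mul
      (16 * (r : ℝ) ^ 2 / (m : ℝ) ^ 2)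
  have hxx : x ⬝ᵥ x = ∑ a, x a ^ 2 := by simp [dotProduct, sq]
  have hx0 : 0 ≤ x ⬝ᵥ x := Finset.sum_nonneg fun i _ => mul_self_nonneg _
  refine (integral_mono_of_nonneg (Filter.Eventually.of_forall fun ω => sq_nonneg _)
    (isA.add ((isB.fun_add isD).const_mul (x ⬝ᵥ x)))
    (Filter.Eventually.of_forall fun ω => sq_dotProduct_qr_col_le_add hm hr (hQ.orthogonal _)
      (hQ.upperTriangular _) x j (h := h) (fun t => min_le_left _ _) hK)).trans ?_
  have e : ∫ ω, (4 / (m : ℝ) * ∑ k : Fin r, (∑ a, x a * G ω a (Fin.castLE hr k)) ^ 2 +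
      (x ⬝ᵥ x) * (16 / (m : ℝ) ^ 2 *
        ∑ k : Fin r, (∑ a, (h (G ω a (Fin.castLE hr k)) - μ)) ^ 2 +
        16 * (r : ℝ) ^ 2 / (m : ℝ) ^ 2 * ∑ k : Fin r, ∑ l : Fin r, if k = l then 0 else
          (∑ a, G ω a (Fin.castLE hr k) * G ω a (Fin.castLE hr l)) ^ 2)) ∂P
      ≤ 4 / (m : ℝ) * (r * (x ⬝ᵥ x)) + (x ⬝ᵥ x) * (16 / (m : ℝ) ^ 2 * (r * (σ * m)) +
        16 * (r : ℝ) ^ 2 / (m : ℝ) ^ 2 * (r * (r * m))) := by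
    rw [integral_add isA ((isB.fun_add isD).const_mul (x ⬝ᵥ x)), integral_const_mul,
      integral_const_mul, integral_add isB isD, integral_const_mul, integral_const_mul,
      integral_finsetSum _ fun k _ => iA _, integral_finsetSum _ fun k _ => iB _,
      integral_finsetSum _ fun k _ => integrable_finsetSum _ fun l _ => iD k l]
    have eD : ∑ k : Fin r, ∫ ω, ∑ l : Fin r, (if k = l then 0 else
        (∑ a, G ω a (Fin.castLE hr k) * G ω a (Fin.castLE hr l)) ^ 2) ∂P ≤ r * (r * m) := by
      calc _ ≤ ∑ _k : Fin r, (r * m : ℝ) := Finset.sum_le_sum fun k _ => by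
            rw [integral_finsetSum _ fun l _ => iD k l]
            calc _ ≤ ∑ _l : Fin r, (m : ℝ) := Finset.sum_le_sum fun l _ => vD k l
              _ = _ := by simp
        _ = _ := by simp
    simp only [hA, hB, one_mul, Finset.sum_const, Finset.card_univ,
      Fintype.card_fin, nsmul_eq_mul, ← hxx]
    gcongr
  refine e.trans ?_
  have hs : (x ⬝ᵥ x) * (16 / (m : ℝ) ^ 2 * (r * (σ * m))) ≤
      (x ⬝ᵥ x) * (16 / (m : ℝ) ^ 2 * (r * ((K : ℝ) ^ 2 * m))) := by gcongr
  have hf : 4 / (m : ℝ) * (r * (x ⬝ᵥ x)) + (x ⬝ᵥ x) * (16 / (m : ℝ) ^ 2 * (r * ((K : ℝ) ^ 2 * m)) +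
        16 * (r : ℝ) ^ 2 / (m : ℝ) ^ 2 * (r * (r * m)))
      = (4 * r + 16 * r * (K : ℝ) ^ 2 + 16 * r ^ 4) * (x ⬝ᵥ x) / m := by
    field_simp
    ring
  linarith

/-! ### The perturbations as linear forms in the noise. -/

/-- The coefficients, as a linear form in the noise `X`, of the `a`-th entry of the signal-subspace
component of the perturbation of the `i`-th singular vector. -/
def signalCoef {p q r : ℕ} (S : Matrix (Fin p) (Fin p) ℝ) (T : Matrix (Fin q) (Fin q) ℝ)
    (d δ : Fin r → ℝ) (i : Fin r) (a : Fin p) (u : Matrix (Fin p) (Fin r) ℝ)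
    (v : Matrix (Fin q) (Fin r) ℝ) : Matrix (Fin p) (Fin q) ℝ :=
  d i • vecMulVec (S *ᵥ (u *ᵥ fun j => δ j * u a j)) (T *ᵥ v.col i)
    + vecMulVec (S *ᵥ u.col i) (T *ᵥ (v *ᵥ fun j => d j * (δ j * u a j)))

/-- The coefficients of the `a`-th entry of the noise-subspace component. -/
def noiseCoef {p q r : ℕ} (S : Matrix (Fin p) (Fin p) ℝ) (T : Matrix (Fin q) (Fin q) ℝ)
    (d : Fin r → ℝ) (i : Fin r) (a : Fin p) (u : Matrix (Fin p) (Fin r) ℝ)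
    (v : Matrix (Fin q) (Fin r) ℝ) : Matrix (Fin p) (Fin q) ℝ :=
  (d i)⁻¹ • vecMulVec (S *ᵥ (Pi.single a 1 - u *ᵥ u.row a)) (T *ᵥ v.col i)

section
variable {p q r : ℕ}

theorem sum_vecMulVec_mul_vecMulVec (x x' : Fin p → ℝ) (y y' : Fin q → ℝ) :
    ∑ s : Fin p × Fin q, vecMulVec x y s.1 s.2 * vecMulVec x' y' s.1 s.2
      = (x ⬝ᵥ x') * (y ⬝ᵥ y') := by
  simp only [dotProduct, Finset.sum_mul_sum, Fintype.sum_prod_type, vecMulVec_apply]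
  exact Finset.sum_congr rfl fun _ _ => Finset.sum_congr rfl fun _ _ => by ring

/-- Moving `S` to the left vector turns the bilinear form into the pairing of `X` with a rank-one
matrix, whose norms and inner products factor. -/
theorem dotProduct_mulVec_eq_sum {S : Matrix (Fin p) (Fin p) ℝ} {T : Matrix (Fin q) (Fin q) ℝ}
    (hS : Sᵀ = S) (X : Matrix (Fin p) (Fin q) ℝ) (x : Fin p → ℝ) (y : Fin q → ℝ) :
    x ⬝ᵥ ((S * X * T) *ᵥ y)
      = ∑ s : Fin p × Fin q, vecMulVec (S *ᵥ x) (T *ᵥ y) s.1 s.2 * X s.1 s.2 := by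
  have h : x ⬝ᵥ ((S * X * T) *ᵥ y) = (S *ᵥ x) ⬝ᵥ (X *ᵥ (T *ᵥ y)) := by
    rw [← mulVec_mulVec, ← mulVec_mulVec, dotProduct_mulVec]
    congr 1
    conv_rhs => rw [← hS, mulVec_transpose]
  rw [h, Fintype.sum_prod_type]
  generalize S *ᵥ x = x'
  generalize T *ᵥ y = y'
  simp only [dotProduct, mulVec, Finset.mul_sum, vecMulVec_apply]
  exact Finset.sum_congr rfl fun _ _ => Finset.sum_congr rfl fun _ _ => by ring

theorem mulVec_apply_eq_dotProduct {m n : ℕ} (M : Matrix (Fin m) (Fin n) ℝ) (w : Fin n → ℝ)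
    (a : Fin m) : (M *ᵥ w) a = (Mᵀ *ᵥ Pi.single a 1) ⬝ᵥ w := by
  rw [mulVec_single_one]
  rfl

theorem signalCoef_sum {S : Matrix (Fin p) (Fin p) ℝ} {T : Matrix (Fin q) (Fin q) ℝ}
    (hS : Sᵀ = S) (X : Matrix (Fin p) (Fin q) ℝ) (d δ : Fin r → ℝ) (i : Fin r) (a : Fin p)
    (u : Matrix (Fin p) (Fin r) ℝ) (v : Matrix (Fin q) (Fin r) ℝ) :
    (d i • ((u * diagonal δ * uᵀ * (S * X * T)) *ᵥ v.col i)
      + (u * diagonal δ * diagonal d * vᵀ * (S * X * T)ᵀ) *ᵥ u.col i) a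
      = ∑ s : Fin p × Fin q, signalCoef S T d δ i a u v s.1 s.2 * X s.1 s.2 := by
  have hrow : uᵀ *ᵥ Pi.single a 1 = u.row a := by rw [mulVec_single_one]; rfl
  have h1 : ((u * diagonal δ * uᵀ * (S * X * T)) *ᵥ v.col i) a
      = (u *ᵥ fun j => δ j * u a j) ⬝ᵥ ((S * X * T) *ᵥ v.col i) := by
    rw [← mulVec_mulVec, mulVec_apply_eq_dotProduct]
    congr 1
    rw [transpose_mul, transpose_mul, transpose_transpose, diagonal_transpose, ← mulVec_mulVec,
      ← mulVec_mulVec, hrow]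
    congr 1
    ext j
    rw [mulVec_diagonal]
    rfl
  have h2 : ((u * diagonal δ * diagonal d * vᵀ * (S * X * T)ᵀ) *ᵥ u.col i) a
      = u.col i ⬝ᵥ ((S * X * T) *ᵥ (v *ᵥ fun j => d j * (δ j * u a j))) := by
    rw [← mulVec_mulVec, mulVec_apply_eq_dotProduct, dotProduct_comm, mulVec_transpose,
      ← dotProduct_mulVec]
    congr 2
    rw [transpose_mul, transpose_mul, transpose_mul, transpose_transpose, diagonal_transpose,
      diagonal_transpose, ← mulVec_mulVec, ← mulVec_mulVec, ← mulVec_mulVec, hrow]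
    congr 1
    ext j
    rw [mulVec_diagonal, mulVec_diagonal]
    rfl
  rw [Pi.add_apply, Pi.smul_apply, h1, h2, dotProduct_mulVec_eq_sum hS,
    dotProduct_mulVec_eq_sum hS, smul_eq_mul, Finset.mul_sum, ← Finset.sum_add_distrib]
  refine Finset.sum_congr rfl fun s _ => ?_
  simp only [signalCoef, Matrix.add_apply, Matrix.smul_apply, smul_eq_mul]
  ring

theorem noiseCoef_sum {S : Matrix (Fin p) (Fin p) ℝ} {T : Matrix (Fin q) (Fin q) ℝ}
    (hS : Sᵀ = S) (X : Matrix (Fin p) (Fin q) ℝ) (d : Fin r → ℝ) (i : Fin r) (a : Fin p)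
    (u : Matrix (Fin p) (Fin r) ℝ) (v : Matrix (Fin q) (Fin r) ℝ) :
    ((d i)⁻¹ • (((1 - u * uᵀ) * (S * X * T)) *ᵥ v.col i)) a
      = ∑ s : Fin p × Fin q, noiseCoef S T d i a u v s.1 s.2 * X s.1 s.2 := by
  have h1 : (((1 - u * uᵀ) * (S * X * T)) *ᵥ v.col i) a
      = (Pi.single a 1 - u *ᵥ u.row a) ⬝ᵥ ((S * X * T) *ᵥ v.col i) := by
    rw [← mulVec_mulVec, mulVec_apply_eq_dotProduct]
    congr 1
    rw [transpose_sub, transpose_one, transpose_mul, transpose_transpose, sub_mulVec, one_mulVec,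
      ← mulVec_mulVec, mulVec_single_one]
    rfl
  rw [Pi.smul_apply, h1, dotProduct_mulVec_eq_sum hS, smul_eq_mul, Finset.mul_sum]
  refine Finset.sum_congr rfl fun s _ => ?_
  simp only [noiseCoef, Matrix.smul_apply, smul_eq_mul]
  ring

/-! ### Norms and inner products of the coefficient matrices. -/

theorem abs_dotProduct_le {n : ℕ} {x y : Fin n → ℝ} {a b : ℝ} (ha : 0 ≤ a) (hb : 0 ≤ b)
    (hx : x ⬝ᵥ x ≤ a ^ 2) (hy : y ⬝ᵥ y ≤ b ^ 2) : |x ⬝ᵥ y| ≤ a * b := by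
  refine abs_le_of_sq_le_sq ?_ (mul_nonneg ha hb)
  rw [mul_pow]
  exact (dotProduct_sq_le x y).trans
    (mul_le_mul hx hy (Finset.sum_nonneg fun i _ => mul_self_nonneg _) (sq_nonneg a))

theorem mulVec_dotProduct_mulVec {m n : ℕ} {u : Matrix (Fin m) (Fin n) ℝ} (hu : uᵀ * u = 1)
    (x y : Fin n → ℝ) : (u *ᵥ x) ⬝ᵥ (u *ᵥ y) = x ⬝ᵥ y := by
  rw [dotProduct_mulVec, ← mulVec_transpose, mulVec_mulVec, hu, one_mulVec]

theorem col_dotProduct_col_self {m n : ℕ} {u : Matrix (Fin m) (Fin n) ℝ} (hu : uᵀ * u = 1)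
    (i : Fin n) : u.col i ⬝ᵥ u.col i = 1 := by
  have := congrFun (congrFun hu i) i
  simpa [mul_apply, dotProduct] using this

theorem dotProduct_smul_le {n : ℕ} {x c : Fin n → ℝ} {L s : ℝ} (hc : ∀ j, |c j| ≤ L)
    (hx : x ⬝ᵥ x ≤ s ^ 2) : (fun j => c j * x j) ⬝ᵥ (fun j => c j * x j) ≤ (L * s) ^ 2 := by
  calc (fun j => c j * x j) ⬝ᵥ (fun j => c j * x j) ≤ ∑ j, L ^ 2 * (x j * x j) := by
        refine Finset.sum_le_sum fun j _ => ?_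
        have h : c j ^ 2 ≤ L ^ 2 := sq_le_sq' (abs_le.mp (hc j)).1 (abs_le.mp (hc j)).2
        nlinarith [mul_le_mul_of_nonneg_right h (mul_self_nonneg (x j))]
    _ = L ^ 2 * (x ⬝ᵥ x) := by rw [← Finset.mul_sum]; rfl
    _ ≤ (L * s) ^ 2 := by rw [mul_pow]; exact mul_le_mul_of_nonneg_left hx (sq_nonneg L)

/-- Pythagoras: `u *ᵥ u.row a` is the orthogonal projection of `e_a` onto the column space of `u`,
and its squared norm is that of the row. -/
theorem residual_dotProduct_self {u : Matrix (Fin p) (Fin r) ℝ} (hu : uᵀ * u = 1) (a : Fin p) :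
    (Pi.single a 1 - u *ᵥ u.row a) ⬝ᵥ (Pi.single a 1 - u *ᵥ u.row a)
      = 1 - u.row a ⬝ᵥ u.row a := by
  have h : (u *ᵥ u.row a) a = u.row a ⬝ᵥ u.row a := rfl
  simp only [sub_dotProduct, dotProduct_sub, mulVec_dotProduct_mulVec hu, single_dotProduct,
    dotProduct_single, h]
  simp [h]

theorem row_dotProduct_self_le_one {u : Matrix (Fin p) (Fin r) ℝ} (hu : uᵀ * u = 1) (a : Fin p) :
    u.row a ⬝ᵥ u.row a ≤ 1 := by
  have h := residual_dotProduct_self hu a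
  have : 0 ≤ (Pi.single a 1 - u *ᵥ u.row a) ⬝ᵥ (Pi.single a 1 - u *ᵥ u.row a) :=
    Finset.sum_nonneg fun i _ => mul_self_nonneg _
  linarith

section bounds
variable {S : Matrix (Fin p) (Fin p) ℝ} {T : Matrix (Fin q) (Fin q) ℝ} {k L : ℝ}
  {d δ : Fin r → ℝ} {i : Fin r} {u : Matrix (Fin p) (Fin r) ℝ} {v : Matrix (Fin q) (Fin r) ℝ}

/-- The residual of `e_a` and the vector `v_i` have norm at most one, so only operator norms and
`d_i⁻¹` contribute. There is no small factor here, which is why this component is bounded at order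
`1/n`. -/
theorem sum_noiseCoef_sq_le
    (hSk : ∀ x, (S *ᵥ x) ⬝ᵥ (S *ᵥ x) ≤ k ^ 2 * (x ⬝ᵥ x))
    (hTk : ∀ x, (T *ᵥ x) ⬝ᵥ (T *ᵥ x) ≤ k ^ 2 * (x ⬝ᵥ x))
    (hdi : 0 < d i) (hdi' : (d i)⁻¹ ≤ k ^ 2) (hu : uᵀ * u = 1) (hv : vᵀ * v = 1) (a : Fin p) :
    ∑ s : Fin p × Fin q, noiseCoef S T d i a u v s.1 s.2 ^ 2 ≤ k ^ 8 := by
  have h1 := hSk (Pi.single a 1 - u *ᵥ u.row a)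
  have h2 := hTk (v.col i)
  rw [col_dotProduct_col_self hv, mul_one] at h2
  rw [residual_dotProduct_self hu] at h1
  have h0 : 0 ≤ u.row a ⬝ᵥ u.row a := Finset.sum_nonneg fun i _ => mul_self_nonneg _
  have h1' := h1.trans (mul_le_of_le_one_right (sq_nonneg k) (by linarith))
  have e : ∑ s : Fin p × Fin q, noiseCoef S T d i a u v s.1 s.2 ^ 2
      = ((d i)⁻¹) ^ 2 * (((S *ᵥ (Pi.single a 1 - u *ᵥ u.row a)) ⬝ᵥ
        (S *ᵥ (Pi.single a 1 - u *ᵥ u.row a))) * ((T *ᵥ v.col i) ⬝ᵥ (T *ᵥ v.col i))) := by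
    rw [← sum_vecMulVec_mul_vecMulVec, Finset.mul_sum]
    refine Finset.sum_congr rfl fun s _ => ?_
    simp only [noiseCoef, Matrix.smul_apply, smul_eq_mul]
    ring
  rw [e]
  have n1 : 0 ≤ (T *ᵥ v.col i) ⬝ᵥ (T *ᵥ v.col i) := Finset.sum_nonneg fun i _ => mul_self_nonneg _
  have n2 : 0 ≤ (S *ᵥ (Pi.single a 1 - u *ᵥ u.row a)) ⬝ᵥ
      (S *ᵥ (Pi.single a 1 - u *ᵥ u.row a)) := Finset.sum_nonneg fun i _ => mul_self_nonneg _
  have n3 := mul_nonneg n2 n1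
  have n4 : 0 ≤ (d i)⁻¹ := (inv_pos.mpr hdi).le
  calc _ ≤ (k ^ 2) ^ 2 * (k ^ 2 * k ^ 2) := by gcongr
    _ = k ^ 8 := by ring

/-- Both rank-one terms contain one vector linear in the row `u.row a`; orthonormal columns preserve
its norm, so the squared norm of that row factors out. -/
theorem sum_signalCoef_sq_le
    (hSk : ∀ x, (S *ᵥ x) ⬝ᵥ (S *ᵥ x) ≤ k ^ 2 * (x ⬝ᵥ x))
    (hTk : ∀ x, (T *ᵥ x) ⬝ᵥ (T *ᵥ x) ≤ k ^ 2 * (x ⬝ᵥ x))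
    (hd : ∀ j, |d j| ≤ k ^ 2) (hδ : ∀ j, |δ j| ≤ L)
    (hu : uᵀ * u = 1) (hv : vᵀ * v = 1) (a : Fin p) :
    ∑ s : Fin p × Fin q, signalCoef S T d δ i a u v s.1 s.2 ^ 2
      ≤ 4 * k ^ 8 * L ^ 2 * (u.row a ⬝ᵥ u.row a) := by
  have h0 : 0 ≤ u.row a ⬝ᵥ u.row a := Finset.sum_nonneg fun i _ => mul_self_nonneg _
  obtain ⟨s, hs0, hs⟩ : ∃ s : ℝ, 0 ≤ s ∧ u.row a ⬝ᵥ u.row a = s ^ 2 :=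
    ⟨_, Real.sqrt_nonneg _, (Real.sq_sqrt h0).symm⟩
  have hδq := dotProduct_smul_le hδ hs.le
  have hdδq := dotProduct_smul_le hd hδq
  set α := S *ᵥ (u *ᵥ fun j => δ j * u.row a j) with hα
  set β := T *ᵥ v.col i with hβ
  set γ := S *ᵥ u.col i with hγ
  set η := T *ᵥ (v *ᵥ fun j => d j * (δ j * u.row a j)) with hη
  have bα : α ⬝ᵥ α ≤ k ^ 2 * (L * s) ^ 2 := by
    refine (hSk _).trans ?_
    rw [mulVec_dotProduct_mulVec hu]
    exact mul_le_mul_of_nonneg_left hδq (sq_nonneg k)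
  have bη : η ⬝ᵥ η ≤ k ^ 2 * (k ^ 2 * (L * s)) ^ 2 := by
    refine (hTk _).trans ?_
    rw [mulVec_dotProduct_mulVec hv]
    exact mul_le_mul_of_nonneg_left hdδq (sq_nonneg k)
  have bβ : β ⬝ᵥ β ≤ k ^ 2 := by
    refine (hTk _).trans ?_
    rw [col_dotProduct_col_self hv, mul_one]
  have bγ : γ ⬝ᵥ γ ≤ k ^ 2 := by
    refine (hSk _).trans ?_
    rw [col_dotProduct_col_self hu, mul_one]
  have nβ : 0 ≤ β ⬝ᵥ β := Finset.sum_nonneg fun i _ => mul_self_nonneg _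
  have nα : 0 ≤ α ⬝ᵥ α := Finset.sum_nonneg fun i _ => mul_self_nonneg _
  have nη : 0 ≤ η ⬝ᵥ η := Finset.sum_nonneg fun i _ => mul_self_nonneg _
  have hdi : d i ^ 2 ≤ (k ^ 2) ^ 2 := sq_le_sq' (abs_le.mp (hd i)).1 (abs_le.mp (hd i)).2
  have e : ∑ s : Fin p × Fin q, signalCoef S T d δ i a u v s.1 s.2 ^ 2
      ≤ 2 * d i ^ 2 * ((α ⬝ᵥ α) * (β ⬝ᵥ β)) + 2 * ((γ ⬝ᵥ γ) * (η ⬝ᵥ η)) := by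
    rw [← sum_vecMulVec_mul_vecMulVec, ← sum_vecMulVec_mul_vecMulVec, Finset.mul_sum,
      Finset.mul_sum, ← Finset.sum_add_distrib]
    refine Finset.sum_le_sum fun s _ => ?_
    change (d i * vecMulVec α β s.1 s.2 + vecMulVec γ η s.1 s.2) ^ 2 ≤ _
    linarith [sq_nonneg (d i * vecMulVec α β s.1 s.2 - vecMulVec γ η s.1 s.2)]
  refine e.trans ?_
  calc _ ≤ 2 * (k ^ 2) ^ 2 * ((k ^ 2 * (L * s) ^ 2) * k ^ 2)
        + 2 * (k ^ 2 * (k ^ 2 * (k ^ 2 * (L * s)) ^ 2)) := by gcongr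
    _ = 4 * k ^ 8 * L ^ 2 * (u.row a ⬝ᵥ u.row a) := by rw [hs]; ring

/-- One small factor comes from the row of `u` in the signal coefficients. The second comes from
orthogonality: the left vectors of the signal coefficients are `S` applied to the range of `u`, and
pairing them with `S` times the residual of `e_a` produces only `uᵀ S² e_a` and the row itself.
Hence the bound is quadratic in small quantities. -/
theorem abs_sum_signalCoef_mul_noiseCoef_le (hk : 0 ≤ k) (hL : 0 ≤ L) (hS : Sᵀ = S)
    (hSk : ∀ x, (S *ᵥ x) ⬝ᵥ (S *ᵥ x) ≤ k ^ 2 * (x ⬝ᵥ x))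
    (hTk : ∀ x, (T *ᵥ x) ⬝ᵥ (T *ᵥ x) ≤ k ^ 2 * (x ⬝ᵥ x))
    (hd : ∀ j, |d j| ≤ k ^ 2) (hdi : 0 < d i) (hdi' : (d i)⁻¹ ≤ k ^ 2) (hδ : ∀ j, |δ j| ≤ L)
    (hu : uᵀ * u = 1) (hv : vᵀ * v = 1) (a : Fin p) :
    |∑ s : Fin p × Fin q, signalCoef S T d δ i a u v s.1 s.2 * noiseCoef S T d i a u v s.1 s.2|
      ≤ L * (k ^ 2 + k ^ 6) * (1 + k ^ 2) * (u.row a ⬝ᵥ u.row a +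
        (uᵀ *ᵥ (S *ᵥ (S *ᵥ Pi.single a 1))) ⬝ᵥ (uᵀ *ᵥ (S *ᵥ (S *ᵥ Pi.single a 1)))) := by
  set z := uᵀ *ᵥ (S *ᵥ (S *ᵥ Pi.single a 1)) with hz
  have h0 : 0 ≤ u.row a ⬝ᵥ u.row a := Finset.sum_nonneg fun i _ => mul_self_nonneg _
  obtain ⟨s, hs0, hs⟩ : ∃ s : ℝ, 0 ≤ s ∧ u.row a ⬝ᵥ u.row a = s ^ 2 :=
    ⟨_, Real.sqrt_nonneg _, (Real.sq_sqrt h0).symm⟩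
  have hz0 : 0 ≤ z ⬝ᵥ z := Finset.sum_nonneg fun i _ => mul_self_nonneg _
  obtain ⟨t, ht0, ht⟩ : ∃ t : ℝ, 0 ≤ t ∧ z ⬝ᵥ z = t ^ 2 :=
    ⟨_, Real.sqrt_nonneg _, (Real.sq_sqrt hz0).symm⟩
  have hδq := dotProduct_smul_le hδ hs.le
  have hdδq := dotProduct_smul_le hd hδq
  set α := S *ᵥ (u *ᵥ fun j => δ j * u.row a j) with hα
  set β := T *ᵥ v.col i with hβ
  set γ := S *ᵥ u.col i with hγ
  set η := T *ᵥ (v *ᵥ fun j => d j * (δ j * u.row a j)) with hη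
  set θ := S *ᵥ (u *ᵥ u.row a) with hθ
  -- Symmetry of `S` gives `⟨S u y, S e_a⟩ = ⟨y, uᵀ S² e_a⟩`, which is where `z` comes from.
  have hadj : ∀ y, (S *ᵥ (u *ᵥ y)) ⬝ᵥ (S *ᵥ Pi.single a 1) = y ⬝ᵥ z := by
    intro y
    have h1 : ∀ x w : Fin p → ℝ, (S *ᵥ x) ⬝ᵥ w = x ⬝ᵥ (S *ᵥ w) := fun x w => by
      rw [dotProduct_mulVec, ← mulVec_transpose, hS]
    rw [h1, hz, dotProduct_mulVec y, vecMul_transpose]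
  have hw : S *ᵥ (Pi.single a 1 - u *ᵥ u.row a) = S *ᵥ Pi.single a 1 - θ := mulVec_sub _ _ _
  have e : ∑ s : Fin p × Fin q, signalCoef S T d δ i a u v s.1 s.2 * noiseCoef S T d i a u v s.1 s.2
      = ((fun j => δ j * u.row a j) ⬝ᵥ z - α ⬝ᵥ θ) * (β ⬝ᵥ β)
        + (d i)⁻¹ * ((z i - γ ⬝ᵥ θ) * (η ⬝ᵥ β)) := by
    have h1 : α ⬝ᵥ (S *ᵥ (Pi.single a 1 - u *ᵥ u.row a))
        = (fun j => δ j * u.row a j) ⬝ᵥ z - α ⬝ᵥ θ := by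
      rw [hw, dotProduct_sub, hα, hadj]
    have h2 : γ ⬝ᵥ (S *ᵥ (Pi.single a 1 - u *ᵥ u.row a)) = z i - γ ⬝ᵥ θ := by
      have := hadj (Pi.single i 1)
      rw [mulVec_single_one, single_one_dotProduct] at this
      rw [hw, dotProduct_sub, hγ, ← this]
    rw [← h1, ← h2, ← sum_vecMulVec_mul_vecMulVec, ← sum_vecMulVec_mul_vecMulVec, Finset.mul_sum,
      ← Finset.sum_add_distrib]
    refine Finset.sum_congr rfl fun s _ => ?_
    change (d i * vecMulVec α β s.1 s.2 + vecMulVec γ η s.1 s.2) * ((d i)⁻¹ * vecMulVec _ β s.1 s.2)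
      = _
    -- The prefactor `d i` of the first signal term cancels the `(d i)⁻¹` of the noise term.
    field_simp
  have bα : α ⬝ᵥ α ≤ (k * (L * s)) ^ 2 := by
    refine (hSk _).trans ?_
    rw [mulVec_dotProduct_mulVec hu, mul_pow k]
    exact mul_le_mul_of_nonneg_left hδq (sq_nonneg k)
  have bθ : θ ⬝ᵥ θ ≤ (k * s) ^ 2 := by
    refine (hSk _).trans ?_
    rw [mulVec_dotProduct_mulVec hu, mul_pow, hs]
  have bη : η ⬝ᵥ η ≤ (k * (k ^ 2 * (L * s))) ^ 2 := by
    refine (hTk _).trans ?_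
    rw [mulVec_dotProduct_mulVec hv, mul_pow k]
    exact mul_le_mul_of_nonneg_left hdδq (sq_nonneg k)
  have bβ : β ⬝ᵥ β ≤ k ^ 2 := by
    refine (hTk _).trans ?_
    rw [col_dotProduct_col_self hv, mul_one]
  have bγ : γ ⬝ᵥ γ ≤ k ^ 2 := by
    refine (hSk _).trans ?_
    rw [col_dotProduct_col_self hu, mul_one]
  have nβ : 0 ≤ β ⬝ᵥ β := Finset.sum_nonneg fun i _ => mul_self_nonneg _
  have c1 : |(fun j => δ j * u.row a j) ⬝ᵥ z| ≤ (L * s) * t :=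
    abs_dotProduct_le (by positivity) ht0 hδq ht.le
  have c2 : |α ⬝ᵥ θ| ≤ (k * (L * s)) * (k * s) :=
    abs_dotProduct_le (by positivity) (by positivity) bα bθ
  have c3 : |z i| ≤ t := by
    refine abs_le_of_sq_le_sq ?_ ht0
    rw [← ht, sq]
    exact Finset.single_le_sum (f := fun i => z i * z i) (fun i _ => mul_self_nonneg _)
      (Finset.mem_univ i)
  have c4 : |γ ⬝ᵥ θ| ≤ k * (k * s) := abs_dotProduct_le hk (by positivity) bγ bθ
  have c5 : |η ⬝ᵥ β| ≤ (k * (k ^ 2 * (L * s))) * k := abs_dotProduct_le (by positivity) hk bη bβ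
  rw [e, hs, ht]
  have hi0 : 0 ≤ (d i)⁻¹ := (inv_pos.mpr hdi).le
  calc _ ≤ |((fun j => δ j * u.row a j) ⬝ᵥ z - α ⬝ᵥ θ) * (β ⬝ᵥ β)|
        + |(d i)⁻¹ * ((z i - γ ⬝ᵥ θ) * (η ⬝ᵥ β))| := abs_add_le _ _
    _ ≤ ((L * s) * t + (k * (L * s)) * (k * s)) * k ^ 2
        + k ^ 2 * ((t + k * (k * s)) * ((k * (k ^ 2 * (L * s))) * k)) := by
      rw [abs_mul, abs_mul, abs_mul, abs_of_nonneg nβ, abs_of_nonneg hi0]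
      gcongr
      · exact (abs_sub _ _).trans (add_le_add c1 c2)
      · exact (abs_sub _ _).trans (add_le_add c3 c4)
    _ = L * (k ^ 2 + k ^ 6) * (s * t + k ^ 2 * s ^ 2) := by ring
    _ ≤ L * (k ^ 2 + k ^ 6) * ((1 + k ^ 2) * (s ^ 2 + t ^ 2)) := by
      gcongr
      nlinarith [sq_nonneg (s - t), sq_nonneg s, sq_nonneg t, mul_nonneg (sq_nonneg k) (sq_nonneg t)]
    _ = _ := by ring

end bounds
end

/-! ### From delocalization to second moment bounds. -/

theorem measurable_signalCoef {p q r : ℕ} (S : Matrix (Fin p) (Fin p) ℝ)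
    (T : Matrix (Fin q) (Fin q) ℝ) (d δ : Fin r → ℝ) (i : Fin r) (a : Fin p) (s : Fin p × Fin q) :
    Measurable fun W : (Fin p → Fin r → ℝ) × (Fin q → Fin r → ℝ) =>
      signalCoef S T d δ i a (Matrix.of W.1) (Matrix.of W.2) s.1 s.2 := by
  simp only [signalCoef, Matrix.add_apply, Matrix.smul_apply, vecMulVec_apply, mulVec, dotProduct,
    Matrix.col_apply, of_apply, smul_eq_mul]
  fun_prop

theorem measurable_noiseCoef {p q r : ℕ} (S : Matrix (Fin p) (Fin p) ℝ)
    (T : Matrix (Fin q) (Fin q) ℝ) (d : Fin r → ℝ) (i : Fin r) (a : Fin p) (s : Fin p × Fin q) :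
    Measurable fun W : (Fin p → Fin r → ℝ) × (Fin q → Fin r → ℝ) =>
      noiseCoef S T d i a (Matrix.of W.1) (Matrix.of W.2) s.1 s.2 := by
  simp only [noiseCoef, Matrix.smul_apply, vecMulVec_apply, mulVec, dotProduct,
    Matrix.col_apply, Matrix.row_apply, of_apply, smul_eq_mul, Pi.sub_apply]
  fun_prop

/-- The squared norm of `uᵀ x` is the sum of the `r` squared overlaps `(x·u_j)²`, each controlled by
the column estimate. -/
theorem integral_transpose_mulVec_le {p r : ℕ} {Ω : Type*} [MeasurableSpace Ω] {P : Measure Ω}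
    [IsProbabilityMeasure P] {u : Ω → Matrix (Fin p) (Fin r) ℝ}
    (hum : ∀ a j, AEMeasurable (fun ω => u ω a j) P) (hu : ∀ ω, (u ω)ᵀ * u ω = 1) {B N : ℝ}
    (hcol : ∀ (x : Fin p → ℝ) j, ∫ ω, (x ⬝ᵥ (u ω).col j) ^ 2 ∂P ≤ B * (x ⬝ᵥ x) / N)
    (x : Fin p → ℝ) :
    Integrable (fun ω => ((u ω)ᵀ *ᵥ x) ⬝ᵥ ((u ω)ᵀ *ᵥ x)) P ∧
      ∫ ω, ((u ω)ᵀ *ᵥ x) ⬝ᵥ ((u ω)ᵀ *ᵥ x) ∂P ≤ r * B * (x ⬝ᵥ x) / N := by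
  have e : ∀ ω, ((u ω)ᵀ *ᵥ x) ⬝ᵥ ((u ω)ᵀ *ᵥ x) = ∑ j, (x ⬝ᵥ (u ω).col j) ^ 2 := by
    intro ω
    refine Finset.sum_congr rfl fun j _ => ?_
    rw [sq, dotProduct_comm x]
    rfl
  have hint : ∀ j, Integrable (fun ω => (x ⬝ᵥ (u ω).col j) ^ 2) P := by
    intro j
    refine Integrable.of_bound (C := x ⬝ᵥ x) ?_ (Filter.Eventually.of_forall fun ω => ?_)
    · refine AEMeasurable.aestronglyMeasurable (AEMeasurable.pow_const ?_ 2)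
      exact Finset.aemeasurable_fun_sum _ fun a _ => (hum a j).const_mul _
    · rw [Real.norm_of_nonneg (sq_nonneg _)]
      have := dotProduct_sq_le x ((u ω).col j)
      rwa [col_dotProduct_col_self (hu ω), mul_one] at this
  simp_rw [e]
  refine ⟨integrable_finsetSum _ fun j _ => hint j, ?_⟩
  rw [integral_finsetSum _ fun j _ => hint j]
  calc _ ≤ ∑ _j : Fin r, B * (x ⬝ᵥ x) / N := Finset.sum_le_sum fun j _ => hcol x j
    _ = _ := by
      simp only [Finset.sum_const, Finset.card_univ, Fintype.card_fin, nsmul_eq_mul]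
      ring

/-- A constant bounding all the second moments of the first-order perturbations. -/
def perturbationConst (k L B : ℝ) (r : ℕ) : ℝ :=
  8 * k ^ 8 * L ^ 2 + 2 * k ^ 8 + 4 * k ^ 8 * L ^ 2 * (r * B)
    + 2 * (L * (k ^ 2 + k ^ 6) * (1 + k ^ 2) * (r * B + r * B * k ^ 4))

/-- Stated for abstract `S`, `T`, `u`, `v` so that it serves both sides: the right singular vectors
correspond to exchanging the roles and transposing `X`. Delocalization is needed only for `u`, the
frame containing the perturbed vector; for `v` orthonormality suffices. -/
theorem second_moment_bounds {p q r : ℕ} {S : Matrix (Fin p) (Fin p) ℝ}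
    {T : Matrix (Fin q) (Fin q) ℝ} {k L B N : ℝ} {d δ : Fin r → ℝ} {i : Fin r}
    (hk : 0 ≤ k) (hL : 0 ≤ L) (hB : 0 ≤ B) (hN : 0 < N) (hS : Sᵀ = S)
    (hSk : ∀ x, (S *ᵥ x) ⬝ᵥ (S *ᵥ x) ≤ k ^ 2 * (x ⬝ᵥ x))
    (hTk : ∀ x, (T *ᵥ x) ⬝ᵥ (T *ᵥ x) ≤ k ^ 2 * (x ⬝ᵥ x))
    (hd : ∀ j, |d j| ≤ k ^ 2) (hdi : 0 < d i) (hdi' : (d i)⁻¹ ≤ k ^ 2) (hδ : ∀ j, |δ j| ≤ L)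
    {Ω : Type*} [MeasurableSpace Ω] {P : Measure Ω} [IsProbabilityMeasure P]
    {X : Ω → Matrix (Fin p) (Fin q) ℝ}
    (hX : ∀ s : Fin p × Fin q, MemLp (fun ω => X ω s.1 s.2) 2 P)
    (hcov : ∀ s t : Fin p × Fin q,
      ∫ ω, X ω s.1 s.2 * X ω t.1 t.2 ∂P = if s = t then 1 / N else 0)
    {u : Ω → Matrix (Fin p) (Fin r) ℝ} {v : Ω → Matrix (Fin q) (Fin r) ℝ}
    (hum : ∀ a j, AEMeasurable (fun ω => u ω a j) P)
    (hvm : ∀ b j, AEMeasurable (fun ω => v ω b j) P)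
    (hu : ∀ ω, (u ω)ᵀ * u ω = 1) (hv : ∀ ω, (v ω)ᵀ * v ω = 1)
    (hind : IndepFun (fun ω => ((fun a j => u ω a j : Fin p → Fin r → ℝ),
      (fun b j => v ω b j : Fin q → Fin r → ℝ)))
      (fun ω (s : Fin p × Fin q) => X ω s.1 s.2) P)
    (hcol : ∀ (x : Fin p → ℝ) j, ∫ ω, (x ⬝ᵥ (u ω).col j) ^ 2 ∂P ≤ B * (x ⬝ᵥ x) / N)
    (a : Fin p) {f g : Ω → ℝ}
    (hf : ∀ ω, f ω = ∑ s : Fin p × Fin q,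
      signalCoef S T d δ i a (u ω) (v ω) s.1 s.2 * X ω s.1 s.2)
    (hg : ∀ ω, g ω = ∑ s : Fin p × Fin q,
      noiseCoef S T d i a (u ω) (v ω) s.1 s.2 * X ω s.1 s.2) :
    MemLp (fun ω => f ω + g ω) 2 P ∧ MemLp g 2 P ∧
      ∫ ω, (f ω + g ω) ^ 2 ∂P ≤ perturbationConst k L B r / N ∧
      ∫ ω, g ω ^ 2 ∂P ≤ perturbationConst k L B r / N ∧
      ∫ ω, f ω ^ 2 ∂P ≤ perturbationConst k L B r / N ^ 2 ∧
      |∫ ω, (f ω + g ω) ^ 2 ∂P - ∫ ω, g ω ^ 2 ∂P| ≤ perturbationConst k L B r / N ^ 2 := by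
  set W : Ω → (Fin p → Fin r → ℝ) × (Fin q → Fin r → ℝ) :=
    fun ω => (fun a j => u ω a j, fun b j => v ω b j) with hW
  have hWm : AEMeasurable W P :=
    (aemeasurable_pi_lambda _ fun a => aemeasurable_pi_lambda _ fun j => hum a j).prodMk
      (aemeasurable_pi_lambda _ fun b => aemeasurable_pi_lambda _ fun j => hvm b j)
  set cf : Fin p × Fin q → (Fin p → Fin r → ℝ) × (Fin q → Fin r → ℝ) → ℝ :=
    fun s W => signalCoef S T d δ i a (Matrix.of W.1) (Matrix.of W.2) s.1 s.2
  set cg : Fin p × Fin q → (Fin p → Fin r → ℝ) × (Fin q → Fin r → ℝ) → ℝ :=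
    fun s W => noiseCoef S T d i a (Matrix.of W.1) (Matrix.of W.2) s.1 s.2
  have mf : ∀ s, Measurable (cf s) := measurable_signalCoef S T d δ i a
  have mg : ∀ s, Measurable (cg s) := measurable_noiseCoef S T d i a
  have hf' : f = fun ω => ∑ s, cf s (W ω) * X ω s.1 s.2 := funext hf
  have hg' : g = fun ω => ∑ s, cg s (W ω) * X ω s.1 s.2 := funext hg
  have sf : ∀ ω, ∑ s, cf s (W ω) ^ 2 ≤ 4 * k ^ 8 * L ^ 2 * ((u ω).row a ⬝ᵥ (u ω).row a) :=
    fun ω => sum_signalCoef_sq_le hSk hTk hd hδ (hu ω) (hv ω) a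
  have sg : ∀ ω, ∑ s, cg s (W ω) ^ 2 ≤ k ^ 8 :=
    fun ω => sum_noiseCoef_sq_le hSk hTk hdi hdi' (hu ω) (hv ω) a
  -- The deterministic bound on the row gives bounded coefficients, for integrability, and the
  -- cruder order `1/N` for the signal part of the total.
  have sf1 : ∀ ω, ∑ s, cf s (W ω) ^ 2 ≤ 4 * k ^ 8 * L ^ 2 := fun ω =>
    (sf ω).trans (mul_le_of_le_one_right (by positivity) (row_dotProduct_self_le_one (hu ω) a))
  have bf : ∀ s ω, |cf s (W ω)| ≤ 2 * k ^ 4 * L := fun s ω => by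
    refine abs_le_of_sq_le_sq ?_ (by positivity)
    refine (Finset.single_le_sum (f := fun s => cf s (W ω) ^ 2) (fun s _ => sq_nonneg _)
      (Finset.mem_univ s)).trans ((sf1 ω).trans_eq (by ring))
  have bg : ∀ s ω, |cg s (W ω)| ≤ k ^ 4 := fun s ω => by
    refine abs_le_of_sq_le_sq ?_ (by positivity)
    refine (Finset.single_le_sum (f := fun s => cg s (W ω) ^ 2) (fun s _ => sq_nonneg _)
      (Finset.mem_univ s)).trans ((sg ω).trans_eq (by ring))
  have Lf : MemLp f 2 P := hf' ▸ memLp_sum_mul_of_bounded hX hWm mf bf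
  have Lg : MemLp g 2 P := hg' ▸ memLp_sum_mul_of_bounded hX hWm mg bg
  have Eff : ∫ ω, f ω ^ 2 ∂P = 1 / N * ∫ ω, ∑ s, cf s (W ω) ^ 2 ∂P := by
    have := integral_sum_mul_sum hX hcov hWm hind mf mf bf bf
    simp only [← sq] at this
    rw [hf']; exact this
  have Egg : ∫ ω, g ω ^ 2 ∂P = 1 / N * ∫ ω, ∑ s, cg s (W ω) ^ 2 ∂P := by
    have := integral_sum_mul_sum hX hcov hWm hind mg mg bg bg
    simp only [← sq] at this
    rw [hg']; exact this
  have Efg : ∫ ω, f ω * g ω ∂P = 1 / N * ∫ ω, ∑ s, cf s (W ω) * cg s (W ω) ∂P := by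
    rw [hf', hg']; exact integral_sum_mul_sum hX hcov hWm hind mf mg bf bg
  have Esum : ∫ ω, (f ω + g ω) ^ 2 ∂P
      = ∫ ω, f ω ^ 2 ∂P + 2 * ∫ ω, f ω * g ω ∂P + ∫ ω, g ω ^ 2 ∂P := by
    have i1 := Lf.integrable_sq
    have i2 : Integrable (fun ω => 2 * (f ω * g ω)) P := (Lf.integrable_mul Lg).const_mul 2
    rw [← integral_const_mul, ← integral_add i1 i2, ← integral_add (i1.fun_add i2) Lg.integrable_sq]
    refine integral_congr_ae (Filter.Eventually.of_forall fun ω => ?_)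
    change (f ω + g ω) ^ 2 = f ω ^ 2 + 2 * (f ω * g ω) + g ω ^ 2
    ring
  have hrow : ∀ ω, (u ω)ᵀ *ᵥ Pi.single a 1 = (u ω).row a := fun ω => by
    rw [mulVec_single_one]; rfl
  -- Delocalization is used for exactly two test vectors: `e_a`, which gives the row of `u`, and `S²
  -- e_a`, which comes from the cross term.
  obtain ⟨ie, he⟩ := integral_transpose_mulVec_le hum hu hcol (Pi.single a 1)
  obtain ⟨iz, hz⟩ := integral_transpose_mulVec_le hum hu hcol (S *ᵥ (S *ᵥ Pi.single a 1))
  simp only [hrow] at ie he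
  have h1 : (Pi.single a 1 : Fin p → ℝ) ⬝ᵥ Pi.single a 1 = 1 := by simp
  have h2 : (S *ᵥ (S *ᵥ Pi.single a 1)) ⬝ᵥ (S *ᵥ (S *ᵥ Pi.single a 1)) ≤ k ^ 4 := by
    have e1 := hSk (S *ᵥ Pi.single a 1)
    have e2 := hSk (Pi.single a 1)
    rw [h1, mul_one] at e2
    calc _ ≤ _ := e1
      _ ≤ k ^ 2 * k ^ 2 := by gcongr
      _ = k ^ 4 := by ring
  rw [h1, mul_one] at he
  replace hz : ∫ ω, ((u ω)ᵀ *ᵥ (S *ᵥ (S *ᵥ Pi.single a 1))) ⬝ᵥ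
      ((u ω)ᵀ *ᵥ (S *ᵥ (S *ᵥ Pi.single a 1))) ∂P ≤ r * B * k ^ 4 / N := by
    refine hz.trans ?_
    gcongr
  have Jff : ∫ ω, ∑ s, cf s (W ω) ^ 2 ∂P ≤ 4 * k ^ 8 * L ^ 2 * (r * B / N) := by
    calc _ ≤ ∫ ω, 4 * k ^ 8 * L ^ 2 * ((u ω).row a ⬝ᵥ (u ω).row a) ∂P :=
          integral_mono_of_nonneg (Filter.Eventually.of_forall fun ω =>
            Finset.sum_nonneg fun s _ => sq_nonneg _) (ie.const_mul _)
            (Filter.Eventually.of_forall sf)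
      _ ≤ _ := by
        rw [integral_const_mul]
        gcongr
  have const_le : ∀ (F : Ω → ℝ) (c : ℝ), (∀ ω, 0 ≤ F ω) → (∀ ω, F ω ≤ c) → ∫ ω, F ω ∂P ≤ c := by
    intro F c h0 hc
    calc _ ≤ ∫ _, c ∂P := integral_mono_of_nonneg (Filter.Eventually.of_forall h0)
          (integrable_const _) (Filter.Eventually.of_forall hc)
      _ = c := by simp
  have Jff1 := const_le _ _ (fun ω => Finset.sum_nonneg fun s _ => sq_nonneg _) sf1
  have Jgg := const_le _ _ (fun ω => Finset.sum_nonneg fun s _ => sq_nonneg _) sg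
  have Jfg : |∫ ω, ∑ s, cf s (W ω) * cg s (W ω) ∂P|
      ≤ L * (k ^ 2 + k ^ 6) * (1 + k ^ 2) * (r * B / N + r * B * k ^ 4 / N) := by
    refine abs_integral_le_integral_abs.trans ?_
    calc _ ≤ ∫ ω, L * (k ^ 2 + k ^ 6) * (1 + k ^ 2) * ((u ω).row a ⬝ᵥ (u ω).row a +
          ((u ω)ᵀ *ᵥ (S *ᵥ (S *ᵥ Pi.single a 1))) ⬝ᵥ ((u ω)ᵀ *ᵥ (S *ᵥ (S *ᵥ Pi.single a 1)))) ∂P :=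
          integral_mono_of_nonneg (Filter.Eventually.of_forall fun ω => abs_nonneg _)
            ((ie.fun_add iz).const_mul _) (Filter.Eventually.of_forall fun ω =>
              abs_sum_signalCoef_mul_noiseCoef_le hk hL hS hSk hTk hd hdi hdi' hδ (hu ω) (hv ω) a)
      _ ≤ _ := by
        rw [integral_const_mul, integral_add ie iz]
        gcongr
  have Eff1 : ∫ ω, f ω ^ 2 ∂P ≤ 4 * k ^ 8 * L ^ 2 / N := by
    rw [Eff, one_div, inv_mul_eq_div]; gcongr
  have Egg1 : ∫ ω, g ω ^ 2 ∂P ≤ k ^ 8 / N := by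
    rw [Egg, one_div, inv_mul_eq_div]; gcongr
  have Eff2 : ∫ ω, f ω ^ 2 ∂P ≤ 4 * k ^ 8 * L ^ 2 * (r * B) / N ^ 2 := by
    rw [Eff]
    calc _ ≤ 1 / N * (4 * k ^ 8 * L ^ 2 * (r * B / N)) := by gcongr
      _ = _ := by field_simp
  have Efg2 : |∫ ω, f ω * g ω ∂P|
      ≤ L * (k ^ 2 + k ^ 6) * (1 + k ^ 2) * (r * B + r * B * k ^ 4) / N ^ 2 := by
    rw [Efg, abs_mul, abs_of_pos (one_div_pos.mpr hN)]
    calc _ ≤ 1 / N * (L * (k ^ 2 + k ^ 6) * (1 + k ^ 2) * (r * B / N + r * B * k ^ 4 / N)) := by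
          gcongr
      _ = _ := by field_simp
  have p1 : 0 ≤ 4 * k ^ 8 * L ^ 2 * (r * B) := by positivity
  have p2 : 0 ≤ L * (k ^ 2 + k ^ 6) * (1 + k ^ 2) * (r * B + r * B * k ^ 4) := by positivity
  have p3 : 0 ≤ k ^ 8 * L ^ 2 := by positivity
  have p4 : 0 ≤ k ^ 8 := by positivity
  refine ⟨Lf.add Lg, Lg, ?_, ?_, ?_, ?_⟩
  · have hle : ∫ ω, (f ω + g ω) ^ 2 ∂P ≤ 2 * ∫ ω, f ω ^ 2 ∂P + 2 * ∫ ω, g ω ^ 2 ∂P := by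
      rw [← integral_const_mul, ← integral_const_mul,
        ← integral_add (Lf.integrable_sq.const_mul 2) (Lg.integrable_sq.const_mul 2)]
      refine integral_mono_of_nonneg (Filter.Eventually.of_forall fun ω => sq_nonneg _)
        ((Lf.integrable_sq.const_mul 2).fun_add (Lg.integrable_sq.const_mul 2))
        (Filter.Eventually.of_forall fun ω => ?_)
      change (f ω + g ω) ^ 2 ≤ 2 * f ω ^ 2 + 2 * g ω ^ 2
      linarith [sq_nonneg (f ω - g ω)]
    calc _ ≤ 2 * (4 * k ^ 8 * L ^ 2 / N) + 2 * (k ^ 8 / N) := by linarith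
      _ = (8 * k ^ 8 * L ^ 2 + 2 * k ^ 8) / N := by ring
      _ ≤ _ := by
        gcongr
        unfold perturbationConst
        linarith
  · refine Egg1.trans ?_
    gcongr
    unfold perturbationConst
    linarith
  · refine Eff2.trans ?_
    gcongr
    unfold perturbationConst
    linarith
  · have h0 : 0 ≤ ∫ ω, f ω ^ 2 ∂P := integral_nonneg fun ω => sq_nonneg _
    -- The difference is `E f² + 2 E fg`, and both terms are of order `1/N²`.
    rw [Esum, add_sub_cancel_right]
    calc _ ≤ |∫ ω, f ω ^ 2 ∂P| + |2 * ∫ ω, f ω * g ω ∂P| := abs_add_le _ _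
      _ ≤ 4 * k ^ 8 * L ^ 2 * (r * B) / N ^ 2 +
          2 * (L * (k ^ 2 + k ^ 6) * (1 + k ^ 2) * (r * B + r * B * k ^ 4) / N ^ 2) := by
        rw [abs_of_nonneg h0, abs_mul, abs_two]
        gcongr
      _ = (4 * k ^ 8 * L ^ 2 * (r * B) +
          2 * (L * (k ^ 2 + k ^ 6) * (1 + k ^ 2) * (r * B + r * B * k ^ 4))) / N ^ 2 := by ring
      _ ≤ _ := by
        gcongr
        unfold perturbationConst
        linarith

/-! ### Verification of the hypotheses for the spiked model. -/

theorem transpose_mul_diagonal_mul_transpose {m : ℕ} (Q : Matrix (Fin m) (Fin m) ℝ)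
    (c : Fin m → ℝ) : (Q * diagonal c * Qᵀ)ᵀ = Q * diagonal c * Qᵀ := by
  simp only [transpose_mul, transpose_transpose, diagonal_transpose, Matrix.mul_assoc]

theorem sqrt_mulVec_dotProduct_le {m : ℕ} {Q : Matrix (Fin m) (Fin m) ℝ}
    (hQ : Q ∈ orthogonalGroup (Fin m) ℝ) {σ : Fin m → ℝ} {k : ℝ}
    (hσ : ∀ j, |Real.sqrt (σ j)| ≤ k) (x : Fin m → ℝ) :
    ((Q * diagonal (fun j => Real.sqrt (σ j)) * Qᵀ) *ᵥ x) ⬝ᵥ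
      ((Q * diagonal (fun j => Real.sqrt (σ j)) * Qᵀ) *ᵥ x) ≤ k ^ 2 * (x ⬝ᵥ x) := by
  have h1 : Qᵀ * Q = 1 := (mem_orthogonalGroup_iff' _ _).mp hQ
  have h2 : (Qᵀ)ᵀ * Qᵀ = 1 := by
    rw [transpose_transpose]; exact (mem_orthogonalGroup_iff _ _).mp hQ
  have h0 : 0 ≤ x ⬝ᵥ x := Finset.sum_nonneg fun i _ => mul_self_nonneg _
  rw [← mulVec_mulVec, ← mulVec_mulVec, mulVec_dotProduct_mulVec h1]
  have hd : diagonal (fun j => Real.sqrt (σ j)) *ᵥ (Qᵀ *ᵥ x)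
      = fun j => Real.sqrt (σ j) * (Qᵀ *ᵥ x) j := funext fun j => mulVec_diagonal _ _ _
  rw [hd]
  refine (dotProduct_smul_le (s := Real.sqrt (x ⬝ᵥ x)) hσ ?_).trans_eq ?_
  · rw [mulVec_dotProduct_mulVec h2, Real.sq_sqrt h0]
  · rw [mul_pow, Real.sq_sqrt h0]

theorem submatrix_castLE_transpose_mul {m r : ℕ} (hr : r ≤ m) {Q : Matrix (Fin m) (Fin m) ℝ}
    (hQ : Q ∈ orthogonalGroup (Fin m) ℝ) :
    (Q.submatrix id (Fin.castLE hr))ᵀ * Q.submatrix id (Fin.castLE hr) = 1 := by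
  have h1 : Qᵀ * Q = 1 := (mem_orthogonalGroup_iff' _ _).mp hQ
  rw [transpose_submatrix, submatrix_mul _ _ _ id _ Function.bijective_id |>.symm, h1,
    submatrix_one _ (Fin.castLE_injective hr)]

/-- This removes `U_c` and `V_c` from the formulas, leaving coefficients that depend only on the
first `r` singular vectors. -/
theorem complement_mul_transpose {m r : ℕ} (hr : r ≤ m) {Q : Matrix (Fin m) (Fin m) ℝ}
    (hQ : Q ∈ orthogonalGroup (Fin m) ℝ) :
    (Q.submatrix id (Subtype.val : {g : Fin m // r ≤ (g : ℕ)} → Fin m)) *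
        (Q.submatrix id (Subtype.val : {g : Fin m // r ≤ (g : ℕ)} → Fin m))ᵀ
      = 1 - Q.submatrix id (Fin.castLE hr) * (Q.submatrix id (Fin.castLE hr))ᵀ := by
  have h1 : Q * Qᵀ = 1 := (mem_orthogonalGroup_iff _ _).mp hQ
  rw [eq_sub_iff_add_eq, ← h1]
  ext a b
  simp only [Matrix.add_apply, mul_apply, transpose_apply, submatrix_apply, id]
  rw [← Fintype.sum_subtype_add_sum_subtype (fun g : Fin m => r ≤ (g : ℕ))
    (fun g => Q a g * Q b g)]
  congr 1
  refine Fintype.sum_bijective (fun j : Fin r => (⟨Fin.castLE hr j, by simp⟩ :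
    {g : Fin m // ¬ r ≤ (g : ℕ)})) ⟨fun j l h => ?_, fun g => ?_⟩ _ _ fun j => rfl
  · exact Fin.castLE_injective hr (Subtype.ext_iff.mp h)
  · exact ⟨⟨g.1, not_le.mp g.2⟩, rfl⟩

namespace SpikedModel

variable {τ : ℝ} {ν : Measure ℝ} {r p n : ℕ} {Ω : Type*} [MeasurableSpace Ω] {P : Measure Ω}

theorem aemeasurable_U (M : SpikedModel τ ν r p n P) (a b : Fin p) :
    AEMeasurable (fun ω => M.U ω a b) P := by
  have h : AEMeasurable (fun ω => (fun j k => M.Gu ω j k : Fin p → Fin p → ℝ)) P :=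
    aemeasurable_pi_lambda _ fun j => aemeasurable_pi_lambda _ fun k => (M.Gu_law j k).aemeasurable
  exact ((measurable_pi_apply b).comp ((measurable_pi_apply a).comp
    M.qru_spec.measurable)).comp_aemeasurable h

theorem aemeasurable_V (M : SpikedModel τ ν r p n P) (a b : Fin n) :
    AEMeasurable (fun ω => M.V ω a b) P := by
  have h : AEMeasurable (fun ω => (fun j k => M.Gv ω j k : Fin n → Fin n → ℝ)) P :=
    aemeasurable_pi_lambda _ fun j => aemeasurable_pi_lambda _ fun k => (M.Gv_law j k).aemeasurable
  exact ((measurable_pi_apply b).comp ((measurable_pi_apply a).comp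
    M.qrv_spec.measurable)).comp_aemeasurable h

/-- The entries of `X` and those of `Gu`, `Gv` are disjoint blocks of one independent family. -/
theorem indepFun_factors_noise (M : SpikedModel τ ν r p n P) :
    IndepFun (fun ω => ((fun j k => M.Gu ω j k : Fin p → Fin p → ℝ),
      (fun j k => M.Gv ω j k : Fin n → Fin n → ℝ)))
      (fun ω (s : Fin p × Fin n) => M.X ω s.1 s.2) P := by
  classical
  have hm : ∀ s : (Fin p × Fin n) ⊕ (Fin p × Fin p) ⊕ (Fin n × Fin n), AEMeasurable
      (fun ω => Sum.elim (fun jk => M.X ω jk.1 jk.2)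
        (Sum.elim (fun jk => M.Gu ω jk.1 jk.2) (fun jk => M.Gv ω jk.1 jk.2)) s) P := by
    rintro (s | s | s)
    · exact (M.X_law s.1 s.2).aemeasurable
    · exact (M.Gu_law s.1 s.2).aemeasurable
    · exact (M.Gv_law s.1 s.2).aemeasurable
  have h := M.indep.indepFun_finset₀ (Finset.univ.image Sum.inr) (Finset.univ.image Sum.inl)
    (by simp [Finset.disjoint_left]) hm
  refine h.comp (φ := fun y => ((fun j k => y ⟨Sum.inr (Sum.inl (j, k)), by simp⟩ :
      Fin p → Fin p → ℝ), (fun j k => y ⟨Sum.inr (Sum.inr (j, k)), by simp⟩ :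
      Fin n → Fin n → ℝ))) (ψ := fun y s => y ⟨Sum.inl s, by simp⟩) ?_ ?_
  · fun_prop
  · fun_prop

theorem indepFun_vectors_noise (M : SpikedModel τ ν r p n P) :
    IndepFun (fun ω => ((fun a j => M.Ur ω a j : Fin p → Fin r → ℝ),
      (fun b j => M.Vr ω b j : Fin n → Fin r → ℝ)))
      (fun ω (s : Fin p × Fin n) => M.X ω s.1 s.2) P := by
  have hu := M.qru_spec.measurable
  have hv := M.qrv_spec.measurable
  refine M.indepFun_factors_noise.comp (φ := fun y =>
    ((fun a j => M.qru (Matrix.of y.1) a (Fin.castLE M.rank_le_rows j) : Fin p → Fin r → ℝ),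
      (fun b j => M.qrv (Matrix.of y.2) b (Fin.castLE M.rank_le_cols j) : Fin n → Fin r → ℝ)))
    (ψ := id) ?_ measurable_id
  refine Measurable.prodMk ?_ ?_
  · exact measurable_pi_lambda _ fun a => measurable_pi_lambda _ fun j =>
      (measurable_pi_apply _).comp ((measurable_pi_apply a).comp (hu.comp measurable_fst))
  · exact measurable_pi_lambda _ fun a => measurable_pi_lambda _ fun j =>
      (measurable_pi_apply _).comp ((measurable_pi_apply a).comp (hv.comp measurable_snd))

theorem memLp_X (M : SpikedModel τ ν r p n P) (s : Fin p × Fin n) :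
    MemLp (fun ω => M.X ω s.1 s.2) 2 P := by
  have h : MemLp id 2 (P.map fun ω => M.X ω s.1 s.2) := by
    rw [(M.X_law s.1 s.2).map_eq]
    exact memLp_id_gaussianReal' 2 (by simp)
  exact h.comp_of_map (M.X_law s.1 s.2).aemeasurable

theorem integral_X_mul_X [IsProbabilityMeasure P] (M : SpikedModel τ ν r p n P)
    (s t : Fin p × Fin n) :
    ∫ ω, M.X ω s.1 s.2 * M.X ω t.1 t.2 ∂P = if s = t then 1 / (n : ℝ) else 0 := by
  have hmean : ∀ s : Fin p × Fin n, ∫ ω, M.X ω s.1 s.2 ∂P = 0 := fun s => by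
    rw [(M.X_law s.1 s.2).integral_eq, integral_id_gaussianReal]
  have hind : ∀ s t : Fin p × Fin n, s ≠ t →
      IndepFun (fun ω => M.X ω s.1 s.2) (fun ω => M.X ω t.1 t.2) P := fun s t hst =>
    M.indep.indepFun (i := Sum.inl s) (j := Sum.inl t) (by simpa using hst)
  refine integral_mul_eq_ite_of_indepFun (Y := fun (s : Fin p × Fin n) ω => M.X ω s.1 s.2)
    M.memLp_X hind hmean (fun s => ?_) s t
  have h := (M.X_law s.1 s.2).variance_eq
  rw [variance_of_integral_eq_zero (M.memLp_X s).1.aemeasurable (hmean s),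
    variance_id_gaussianReal] at h
  rw [h]
  simp

theorem sqrtA_transpose (M : SpikedModel τ ν r p n P) : M.sqrtAᵀ = M.sqrtA :=
  transpose_mul_diagonal_mul_transpose _ _

theorem sqrtB_transpose (M : SpikedModel τ ν r p n P) : M.sqrtBᵀ = M.sqrtB :=
  transpose_mul_diagonal_mul_transpose _ _

theorem Z_transpose (M : SpikedModel τ ν r p n P) (ω : Ω) :
    (M.Z ω)ᵀ = M.sqrtB * (M.X ω)ᵀ * M.sqrtA := by
  rw [Z, transpose_mul, transpose_mul, sqrtA_transpose, sqrtB_transpose, Matrix.mul_assoc]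

/-- In `d_i² - d_j² = (d_i - d_j)(d_i + d_j)` the gap bounds the first factor below by `τ`, and `d_i
≥ τ` with `d_j > 0` bounds the second. -/
theorem abs_inv_sq_sub_sq_le (hτ : 0 < τ) (M : SpikedModel τ ν r p n P) {i : Fin r}
    (hi : τ ≤ M.d i) (j : Fin r) :
    |if j = i then 0 else 1 / (M.d i ^ 2 - M.d j ^ 2)| ≤ (τ ^ 2)⁻¹ := by
  split_ifs with h
  · simp only [abs_zero]; positivity
  · have h1 := M.d_gap i j (Ne.symm h)
    have h2 : τ ^ 2 ≤ |M.d i ^ 2 - M.d j ^ 2| := by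
      rw [sq_sub_sq, abs_mul, abs_of_pos (add_pos (M.d_pos i) (M.d_pos j)), sq]
      have h3 : τ ≤ M.d i + M.d j := hi.trans (le_add_of_nonneg_right (M.d_pos j).le)
      exact mul_le_mul h3 h1.le hτ.le (hτ.le.trans h3)
    rw [abs_div, abs_one, one_div]
    exact inv_anti₀ (by positivity) h2

theorem duR_apply (M : SpikedModel τ ν r p n P) (i : Fin r) (a : Fin p) (ω : Ω) :
    M.duR i ω a = ∑ s : Fin p × Fin n, signalCoef M.sqrtA M.sqrtB M.d
      (fun j => if j = i then 0 else 1 / (M.d i ^ 2 - M.d j ^ 2)) i a (M.Ur ω) (M.Vr ω) s.1 s.2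
        * M.X ω s.1 s.2 := by
  rw [← signalCoef_sum M.sqrtA_transpose]
  rfl

theorem duC_apply (M : SpikedModel τ ν r p n P) (i : Fin r) (a : Fin p) (ω : Ω) :
    M.duC i ω a = ∑ s : Fin p × Fin n, noiseCoef M.sqrtA M.sqrtB M.d i a (M.Ur ω) (M.Vr ω) s.1 s.2
        * M.X ω s.1 s.2 := by
  rw [← noiseCoef_sum M.sqrtA_transpose, duC, Uc,
    complement_mul_transpose M.rank_le_rows (Q := M.U ω) (M.qru_spec.orthogonal _)]
  rfl

theorem dvR_apply (M : SpikedModel τ ν r p n P) (i : Fin r) (b : Fin n) (ω : Ω) :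
    M.dvR i ω b = ∑ s : Fin n × Fin p, signalCoef M.sqrtB M.sqrtA M.d
      (fun j => if j = i then 0 else 1 / (M.d i ^ 2 - M.d j ^ 2)) i b (M.Vr ω) (M.Ur ω) s.1 s.2
        * (M.X ω)ᵀ s.1 s.2 := by
  rw [← signalCoef_sum M.sqrtB_transpose, ← Z_transpose, transpose_transpose]
  rfl

theorem dvC_apply (M : SpikedModel τ ν r p n P) (i : Fin r) (b : Fin n) (ω : Ω) :
    M.dvC i ω b = ∑ s : Fin n × Fin p, noiseCoef M.sqrtB M.sqrtA M.d i b (M.Vr ω) (M.Ur ω) s.1 s.2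
        * (M.X ω)ᵀ s.1 s.2 := by
  rw [← noiseCoef_sum M.sqrtB_transpose, ← Z_transpose, dvC, Vc,
    complement_mul_transpose M.rank_le_cols (Q := M.V ω) (M.qrv_spec.orthogonal _)]
  rfl

end SpikedModel

theorem perturbationConst_pos {k L B : ℝ} {r : ℕ} (hk : 0 < k) (hL : 0 ≤ L) (hB : 0 ≤ B) :
    0 < perturbationConst k L B r := by
  unfold perturbationConst
  positivity

end

/-! ### Choice of constants and conclusion. -/

theorem mainTheorem3 (τ : ℝ) (hτ0 : 0 < τ) (hτ1 : τ < 1) (r : ℕ)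
    (ν : Measure ℝ) [IsProbabilityMeasure ν]
    (hν_sq : Integrable (fun x : ℝ => x ^ 2) ν) (hν_mean : ∫ x, x ∂ν = 0)
    (hν_var : ∫ x, x ^ 2 ∂ν = 1) (hν_lsi : SatisfiesLogSobolev ν) :
    ∃ C : ℝ, 0 < C ∧ ∃ N : ℕ, ∀ n : ℕ, N ≤ n → ∀ (p : ℕ) (Ω : Type*) [MeasurableSpace Ω]
      (P : Measure Ω) [IsProbabilityMeasure P] (M : SpikedModel τ ν r p n P) (i : Fin r),
      τ ≤ M.d i →
      (∀ a : Fin p,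
        MemLp (fun ω => M.du i ω a) 2 P ∧ MemLp (fun ω => M.duC i ω a) 2 P ∧
        ∫ ω, (M.du i ω a) ^ 2 ∂P ≤ C / n ∧
        ∫ ω, (M.duC i ω a) ^ 2 ∂P ≤ C / n ∧
        ∫ ω, (M.duR i ω a) ^ 2 ∂P ≤ C / (n : ℝ) ^ 2 ∧
        |∫ ω, (M.du i ω a) ^ 2 ∂P - ∫ ω, (M.duC i ω a) ^ 2 ∂P| ≤ C / (n : ℝ) ^ 2) ∧
      (∀ b : Fin n,
        MemLp (fun ω => M.dv i ω b) 2 P ∧ MemLp (fun ω => M.dvC i ω b) 2 P ∧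
        ∫ ω, (M.dv i ω b) ^ 2 ∂P ≤ C / n ∧
        ∫ ω, (M.dvC i ω b) ^ 2 ∂P ≤ C / n ∧
        ∫ ω, (M.dvR i ω b) ^ 2 ∂P ≤ C / (n : ℝ) ^ 2 ∧
        |∫ ω, (M.dv i ω b) ^ 2 ∂P - ∫ ω, (M.dvC i ω b) ^ 2 ∂P| ≤ C / (n : ℝ) ^ 2) := by
  obtain ⟨K, hK⟩ := exists_truncated_moment ν hν_sq hν_var
  set C₁ : ℝ := 4 * r + 16 * r * (K : ℝ) ^ 2 + 16 * r ^ 4 with hC₁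
  have hC₁0 : 0 ≤ C₁ := by positivity
  have hτinv : 0 < τ⁻¹ := inv_pos.mpr hτ0
  -- A single parameter controls everything: `k` bounds the operator norms of the covariance square
  -- roots, and `k² = τ⁻¹` bounds the `d_j` and `d_i⁻¹`.
  set k := Real.sqrt τ⁻¹ with hk
  have hk0 : 0 < k := Real.sqrt_pos.mpr hτinv
  have hk2 : k ^ 2 = τ⁻¹ := Real.sq_sqrt hτinv.le
  have hL : 0 ≤ (τ ^ 2)⁻¹ := by positivity
  -- The factor `τ⁻¹` converts the rate `1/p` for the left vectors into `1/n`, since `n ≤ τ⁻¹ p`.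
  have hB : 0 ≤ C₁ * τ⁻¹ := by positivity
  refine ⟨perturbationConst k (τ ^ 2)⁻¹ (C₁ * τ⁻¹) r, perturbationConst_pos hk0 hL hB, 1, ?_⟩
  intro n hn p Ω _ P _ M i hi
  have hn0 : (0 : ℝ) < n := by exact_mod_cast hn
  have hpn : τ * n < p := (lt_div_iff₀ hn0).mp M.lt_ratio
  have hp0 : (0 : ℝ) < p := lt_trans (by positivity) hpn
  have hp : 0 < p := by exact_mod_cast hp0
  have hd : ∀ j, |M.d j| ≤ k ^ 2 := fun j => by
    rw [abs_of_pos (M.d_pos j), hk2]; exact (M.d_lt j).le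
  have hdi : (M.d i)⁻¹ ≤ k ^ 2 := by rw [hk2]; exact inv_anti₀ hτ0 hi
  have hA : ∀ x, (M.sqrtA *ᵥ x) ⬝ᵥ (M.sqrtA *ᵥ x) ≤ k ^ 2 * (x ⬝ᵥ x) :=
    sqrt_mulVec_dotProduct_le M.Qa_mem fun j => by
      rw [abs_of_nonneg (Real.sqrt_nonneg _)]; exact Real.sqrt_le_sqrt (M.σa_le j)
  have hBk : ∀ x, (M.sqrtB *ᵥ x) ⬝ᵥ (M.sqrtB *ᵥ x) ≤ k ^ 2 * (x ⬝ᵥ x) :=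
    sqrt_mulVec_dotProduct_le M.Qb_mem fun j => by
      rw [abs_of_nonneg (Real.sqrt_nonneg _)]; exact Real.sqrt_le_sqrt (M.σb_le j)
  have hUr : ∀ ω, (M.Ur ω)ᵀ * M.Ur ω = 1 := fun ω =>
    submatrix_castLE_transpose_mul M.rank_le_rows (M.qru_spec.orthogonal _)
  have hVr : ∀ ω, (M.Vr ω)ᵀ * M.Vr ω = 1 := fun ω =>
    submatrix_castLE_transpose_mul M.rank_le_cols (M.qrv_spec.orthogonal _)
  have hUm : ∀ a j, AEMeasurable (fun ω => M.Ur ω a j) P := fun a j => M.aemeasurable_U a _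
  have hVm : ∀ b j, AEMeasurable (fun ω => M.Vr ω b j) P := fun b j => M.aemeasurable_V b _
  have hUcol : ∀ (x : Fin p → ℝ) j,
      ∫ ω, (x ⬝ᵥ (M.Ur ω).col j) ^ 2 ∂P ≤ C₁ * τ⁻¹ * (x ⬝ᵥ x) / n := fun x j => by
    have hx0 : 0 ≤ x ⬝ᵥ x := Finset.sum_nonneg fun i _ => mul_self_nonneg _
    refine (integral_qr_col_sq_le hp M.rank_le_rows hν_sq hν_mean hν_var hK M.Gu_law
      (M.indep.precomp (g := fun s => Sum.inr (Sum.inl s)) (Sum.inr_injective.comp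
        Sum.inl_injective)) M.qru_spec x j).trans ?_
    rw [div_le_div_iff₀ hp0 hn0]
    have h1 : (n : ℝ) ≤ τ⁻¹ * p := by
      rw [inv_mul_eq_div, le_div_iff₀ hτ0]; linarith
    calc C₁ * (x ⬝ᵥ x) * n ≤ C₁ * (x ⬝ᵥ x) * (τ⁻¹ * p) := by gcongr
      _ = _ := by ring
  have hVcol : ∀ (x : Fin n → ℝ) j,
      ∫ ω, (x ⬝ᵥ (M.Vr ω).col j) ^ 2 ∂P ≤ C₁ * τ⁻¹ * (x ⬝ᵥ x) / n := fun x j => by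
    have hx0 : 0 ≤ x ⬝ᵥ x := Finset.sum_nonneg fun i _ => mul_self_nonneg _
    refine (integral_qr_col_sq_le hn M.rank_le_cols hν_sq hν_mean hν_var hK M.Gv_law
      (M.indep.precomp (g := fun s => Sum.inr (Sum.inr s)) (Sum.inr_injective.comp
        Sum.inr_injective)) M.qrv_spec x j).trans ?_
    -- The rate is already `1/n` here; the extra `τ⁻¹ ≥ 1` only serves to share one constant with
    -- the left vectors.
    have h1 : 1 ≤ τ⁻¹ := (one_le_inv₀ hτ0).mpr hτ1.le
    change C₁ * (x ⬝ᵥ x) / n ≤ _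
    gcongr
    exact le_mul_of_one_le_right hC₁0 h1
  have hδ := M.abs_inv_sq_sub_sq_le hτ0 hi
  constructor
  · intro a
    exact second_moment_bounds hk0.le hL hB hn0 M.sqrtA_transpose hA hBk hd (M.d_pos i) hdi hδ
      M.memLp_X M.integral_X_mul_X hUm hVm hUr hVr M.indepFun_vectors_noise hUcol a
      (M.duR_apply i a) (M.duC_apply i a)
  · intro b
    -- The right side is the left side for the transposed noise, with the two frames, the two
    -- covariances and the index pairs swapped.
    have hind := M.indepFun_vectors_noise.comp (φ := Prod.swap)
      (ψ := fun (y : Fin p × Fin n → ℝ) (s : Fin n × Fin p) => y s.swap) measurable_swap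
      (measurable_pi_lambda _ fun s => measurable_pi_apply _)
    have hcov : ∀ s t : Fin n × Fin p, ∫ ω, (M.X ω)ᵀ s.1 s.2 * (M.X ω)ᵀ t.1 t.2 ∂P
        = if s = t then 1 / (n : ℝ) else 0 := fun s t => by
      have := M.integral_X_mul_X s.swap t.swap
      rwa [if_congr (Prod.swap_injective.eq_iff) rfl rfl] at this
    exact second_moment_bounds hk0.le hL hB hn0 M.sqrtB_transpose hBk hA hd (M.d_pos i) hdi hδ
      (X := fun ω => (M.X ω)ᵀ) (fun s => M.memLp_X s.swap) hcov hVm hUm hVr hUr hind hVcol b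
      (M.dvR_apply i b) (M.dvC_apply i b)
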